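/- **Theorem (Merton call price asymptotics).** Let $\sigma,\lambda,\delta,T>0$ and $b,\mu\in\mathbb{R}$. Let $W$ be a standard Brownian motion, $N$ a Poisson process with intensity $\lambda$, and $Y_1,Y_2,\dots$ i.i.d. Gaussian random variables with mean $\mu$ and variance $\delta^2$, with $W$, $N$ and $(Y_j)_j$ independent. Let $X_t=bt+\sigma W_t+\sum_{j=1}^{N_t}Y_j$ be the log-return in Merton's jump diffusion model (interest rate $0$, initial spot $1$), let $C(k,T)=\mathbb{E}[(e^{X_T}-e^k)^+]$ be the price of the call with log-strike $k$ and maturity $T$, and let $M(s,T)=\mathbb{E}[e^{sX_T}]$ and $m(s,T)=\log M(s,T)$ for $s\in\mathbb{R}$, with $m'$, $m''$ denoting derivatives with respect to $s$. Then $e^{sX_T}$ is integrable for every $s\in\mathbb{R}$, the call payoff $(e^{X_T}-e^k)^+$ is integrable for every $k\in\mathbb{R}$, and for every $k\in\mathbb{R}$ the equation $m'(s,T)=k$ has exactly one real solution $s$. Let $\hat s=\hat s(k)$ satisfy $m'(\hat s,T)=k$ for all sufficiently large $k$. Then, as $k\to\infty$, $$C(k,T)=\frac{\delta^2 e^{k(1-\hat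 s)}M(\hat s,T)}{2\log k\,\sqrt{2\pi m''(\hat s,T)}}\left(1+O\left(\frac{1}{\sqrt{\log k}}\right)\right),$$ and, written out with the explicit moment generating function, $$C(k,T)=\frac{\delta^2\exp\left(k(1-\hat s)+T\left(\frac{\sigma^2\hat s^2}{2}+b\hat s+\lambda\left(e^{\delta^2\hat s^2/2+\mu\hat s}-1\right)\right)\right)}{2\log k\,\sqrt{2\pi T\left(\sigma^2+\lambda\left((\delta^2\hat s+\mu)^2+\delta^2\right)e^{\delta^2\hat s^2/2+\mu\hat s}\right)}}\left(1+O\left(\frac{1}{\sqrt{\log k}}\right)\right).$$ The last expansion also holds with $(\delta^2\hat s+\mu)\left((\delta^2\hat s+\mu)+\delta^2\right)$ in place of $(\delta^2\hat s+\mu)^2+\delta^2$. -/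

import Mathlib

open MeasureTheory ProbabilityTheory Filter Asymptotics
open scoped NNReal Topology

namespace MertonModel

variable {Ω : Type*} [MeasurableSpace Ω]

/-- `N` is a Poisson process with intensity `lam` under `P`: almost every path starts at `0` and is
nondecreasing and right-continuous, the increments are independent, and `N t - N s` is Poisson
distributed with parameter `lam * (t - s)` for `s ≤ t`. (The paths being almost surely
nondecreasing, the natural-number subtraction of an increment is the true difference.) -/
structure IsPoissonProcess (N : ℝ≥0 → Ω → ℕ) (lam : ℝ≥0) (P : Measure Ω) : Prop where
  zero : ∀ᵐ ω ∂P, N 0 ω = 0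
  mono : ∀ᵐ ω ∂P, Monotone (fun t => N t ω)
  right_cont : ∀ᵐ ω ∂P, ∀ t, ContinuousWithinAt (fun t => N t ω) (Set.Ici t) t
  indep_increments : HasIndepIncrements N P
  law_increment : ∀ s t : ℝ≥0, s ≤ t →
    HasLaw (fun ω => N t ω - N s ω) (poissonMeasure (lam * (t - s))) P

/-- The driving noise of Merton's jump diffusion: a standard Brownian motion `W`, a Poisson process
`N` with intensity `lam`, and i.i.d. Gaussian jumps `Y 0, Y 1, …` with mean `μ` and variance `δ²`;
the three objects `W`, `N`, `Y` are mutually independent. -/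
structure IsMertonNoise (W : ℝ≥0 → Ω → ℝ) (N : ℝ≥0 → Ω → ℕ) (Y : ℕ → Ω → ℝ)
    (lam : ℝ≥0) (μ : ℝ) (δ : ℝ≥0) (P : Measure Ω) : Prop where
  brownian : IsBrownianReal W P
  poisson : IsPoissonProcess N lam P
  jump_law : ∀ j, HasLaw (Y j) (gaussianReal μ (δ ^ 2)) P
  jump_indep : iIndepFun Y P
  indep_N_Y : IndepFun (fun ω t => N t ω) (fun ω j => Y j ω) P
  indep_W_NY : IndepFun (fun ω t => W t ω)
    (fun ω => ((fun t => N t ω : ℝ≥0 → ℕ), (fun j => Y j ω : ℕ → ℝ))) P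

/-- The log-return `X_t = b t + σ W_t + ∑_{j ≤ N_t} Y_j`; the jumps are numbered from `0`. -/
noncomputable def logReturn (b σ : ℝ) (W : ℝ≥0 → Ω → ℝ) (N : ℝ≥0 → Ω → ℕ) (Y : ℕ → Ω → ℝ)
    (t : ℝ≥0) (ω : Ω) : ℝ :=
  b * t + σ * W t ω + ∑ j ∈ Finset.range (N t ω), Y j ω

/-- The payoff `(e^x - e^k)^+` of a call with log-strike `k` at log-return `x`. -/
noncomputable def callPayoff (k x : ℝ) : ℝ := max (Real.exp x - Real.exp k) 0

/-- The call price `E[(e^X - e^k)^+]` with log-strike `k` for the terminal log-return `X`. -/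
noncomputable def callPrice (X : Ω → ℝ) (P : Measure Ω) (k : ℝ) : ℝ :=
  ∫ ω, callPayoff k (X ω) ∂P

/-- `f(k) = g(k) (1 + O(r(k)))` as `k → ∞`. -/
def EqOneAddO (f g r : ℝ → ℝ) : Prop :=
  ∃ E : ℝ → ℝ, E =O[atTop] r ∧ ∀ᶠ k in atTop, f k = g k * (1 + E k)

end MertonModel

/-! Everything rests on a saddle-point argument. Damping the payoff by `e^{-sy}` and inverting its
Fourier transform gives, for `s ≥ 2`, `2π C(k) = e^{k(1-s)} ∫ M(s+it) e^{-itk} / ((s-1+it)(s+it))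
dt` (`callPrice_eq_integral`). At `k = m'(s)` the linear phase cancels: `M(s+it) e^{-itk}` is `M(s)`
times the characteristic function of a centred, exponentially tilted law (`cumulantC_add_mul_I`).
That law is again of Merton type, with Brownian variance `v = Tσ²`, Poisson intensity `r = Tλ
e^{δ²s²/2+μs}` and jumps of mean `h = δ²s+μ` and variance `δ²`; its variance is `B = v + r(h²+δ²) =
m''(s)`.

As `r` grows superexponentially in `s`, the tilted characteristic function is close to `e^{-Bt²/2}`.
With the kernel normalised to `1` at `t = 0`, the integral differs from `√(2π/B)` by `O(h³/r)`
(`norm_integral_tilted_sub_le`), a relative error of `O(h⁴/√r)`, far below `1/s`.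

The saddle-point formula has `s(s-1)` in the denominator. Since `log m'(s) = δ²s²/2 + O(s)`
(`exists_abs_log_cumulantDeriv_sub_le`), replacing it by `2 log k / δ²` costs a factor `1 + O(1/s)`,
the dominant error. The alternative factor under the root also costs only `1 + O(1/s)`. Finally `1/ŝ
= O(1/√log k)` turns the expansions in `s` into expansions in `k`. -/

namespace MertonModel

/-! ### Exponential moments of compound Poisson sums -/

section Law

variable {Ω : Type*} [MeasurableSpace Ω]

theorem measurable_sum_range_pi :
    Measurable (fun p : ℕ × (ℕ → ℝ) => ∑ j ∈ Finset.range p.1, p.2 j) :=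
  measurable_from_prod_countable_right fun n => by
    change Measurable (fun y : ℕ → ℝ => ∑ j ∈ Finset.range n, y j)
    fun_prop

theorem integrable_pow_poissonMeasure (r : ℝ≥0) (g : ℝ) :
    Integrable (fun n : ℕ => g ^ n) (poissonMeasure r) := by
  rw [integrable_poissonMeasure_iff]
  have := (Real.summable_pow_div_factorial (r * |g|)).mul_left (Real.exp (-r))
  refine this.congr fun n => ?_
  rw [norm_pow, Real.norm_eq_abs, mul_pow]
  ring

theorem integral_pow_poissonMeasure (r : ℝ≥0) (g : ℝ) :
    ∫ n : ℕ, g ^ n ∂(poissonMeasure r) = Real.exp (r * (g - 1)) := by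
  rw [integral_poissonMeasure' (integrable_pow_poissonMeasure r g)]
  have h : ∀ n : ℕ, (Real.exp (-r) * (r : ℝ) ^ n / n.factorial) • g ^ n
      = Real.exp (-r) * ((r * g) ^ n / n.factorial) := fun n => by
    rw [smul_eq_mul, mul_pow]; ring
  simp_rw [h]
  rw [tsum_mul_left, ← congrFun NormedSpace.exp_eq_tsum_div, ← Real.exp_eq_exp_ℝ, ← Real.exp_add]
  congr 1; ring

/-- Exponential moments of a compound Poisson variable. -/
theorem compoundPoisson_exp_moment {P : Measure Ω} [IsProbabilityMeasure P]
    {N : Ω → ℕ} {Y : ℕ → Ω → ℝ} {r : ℝ≥0} (hN : HasLaw N (poissonMeasure r) P)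
    (hY : ∀ j, AEMeasurable (Y j) P) (hind : iIndepFun Y P)
    (hNY : IndepFun N (fun ω j => Y j ω) P) {s g : ℝ} (hg : 0 < g)
    (hmgf : ∀ j, mgf (Y j) P s = g) :
    Integrable (fun ω => Real.exp (s * ∑ j ∈ Finset.range (N ω), Y j ω)) P ∧
      mgf (fun ω => ∑ j ∈ Finset.range (N ω), Y j ω) P s = Real.exp (r * (g - 1)) := by
  have hYm : AEMeasurable (fun ω j => Y j ω) P := aemeasurable_pi_lambda _ hY
  have hSm : AEMeasurable (fun ω => ∑ j ∈ Finset.range (N ω), Y j ω) P :=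
    measurable_sum_range_pi.comp_aemeasurable (hN.aemeasurable.prodMk hYm)
  -- With `ENNReal`-valued integrals, Tonelli applies unconditionally, so the value of the moment is
  -- found first and integrability follows from its finiteness.
  set F : ℕ × (ℕ → ℝ) → ENNReal :=
    fun p => ENNReal.ofReal (Real.exp (s * ∑ j ∈ Finset.range p.1, p.2 j)) with hF
  have hFm : Measurable F := ((measurable_sum_range_pi.const_mul s).exp).ennreal_ofReal
  have hmap := (indepFun_iff_map_prod_eq_prod_map_map hN.aemeasurable hYm).1 hNY
  have hfix : ∀ n : ℕ, ∫⁻ y, F (n, y) ∂(P.map (fun ω j => Y j ω)) = ENNReal.ofReal (g ^ n) := by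
    intro n
    rw [lintegral_map' (by fun_prop) hYm]
    have hsum := hind.mgf_sum₀ (t := s) hY (Finset.range n)
    simp only [hmgf, Finset.prod_const, Finset.card_range] at hsum
    rw [← hsum, mgf, ofReal_integral_eq_lintegral_ofReal]
    · simp [hF]
    -- A positive moment generating function forces integrability, because the Bochner integral of a
    -- non-integrable function is `0`.
    · rw [← mgf_pos_iff, hsum]; positivity
    · exact .of_forall fun ω => (Real.exp_pos _).le
  have key : ∫⁻ ω, ENNReal.ofReal (Real.exp (s * ∑ j ∈ Finset.range (N ω), Y j ω)) ∂P
      = ENNReal.ofReal (Real.exp (r * (g - 1))) := by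
    calc _ = ∫⁻ ω, F (N ω, fun j => Y j ω) ∂P := rfl
      _ = ∫⁻ p, F p ∂(P.map (fun ω => (N ω, fun j => Y j ω))) :=
        (lintegral_map' hFm.aemeasurable (hN.aemeasurable.prodMk hYm)).symm
      _ = ∫⁻ n, ENNReal.ofReal (g ^ n) ∂(poissonMeasure r) := by
        have := Measure.isProbabilityMeasure_map (μ := P) hYm
        rw [hmap, lintegral_prod _ hFm.aemeasurable, hN.map_eq]
        simp_rw [hfix]
      _ = _ := by
        rw [← ofReal_integral_eq_lintegral_ofReal (integrable_pow_poissonMeasure r g)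
          (.of_forall fun n => by positivity), integral_pow_poissonMeasure]
  have hint : Integrable (fun ω => Real.exp (s * ∑ j ∈ Finset.range (N ω), Y j ω)) P := by
    refine ⟨(hSm.const_mul s).exp.aestronglyMeasurable, ?_⟩
    rw [hasFiniteIntegral_iff_ofReal (.of_forall fun ω => (Real.exp_pos _).le), key]
    exact ENNReal.ofReal_lt_top
  refine ⟨hint, ?_⟩
  rw [mgf, integral_eq_lintegral_of_nonneg_ae (.of_forall fun ω => (Real.exp_pos _).le)
    hint.aestronglyMeasurable, key, ENNReal.toReal_ofReal (Real.exp_pos _).le]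

end Law

/-! ### The explicit cumulant function and the saddle-point equation -/

/-- The cumulant generating function of the log-return at maturity `T`. -/
noncomputable def cumulant (b σ μ lam δ T : ℝ) (s : ℝ) : ℝ :=
  T * (σ ^ 2 * s ^ 2 / 2 + b * s + lam * (Real.exp (δ ^ 2 * s ^ 2 / 2 + μ * s) - 1))

/-- Its first derivative. -/
noncomputable def cumulantDeriv (b σ μ lam δ T : ℝ) (s : ℝ) : ℝ :=
  T * (σ ^ 2 * s + b + lam * ((δ ^ 2 * s + μ) * Real.exp (δ ^ 2 * s ^ 2 / 2 + μ * s)))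

/-- Its second derivative. -/
noncomputable def cumulantDeriv₂ (σ μ lam δ T : ℝ) (s : ℝ) : ℝ :=
  T * (σ ^ 2 + lam * ((δ ^ 2 * s + μ) ^ 2 + δ ^ 2) * Real.exp (δ ^ 2 * s ^ 2 / 2 + μ * s))

/-- The entire extension of the moment generating function. -/
noncomputable def cumulantC (b σ μ lam δ T : ℝ) (z : ℂ) : ℂ :=
  T * (σ ^ 2 * z ^ 2 / 2 + b * z + lam * (Complex.exp (δ ^ 2 * z ^ 2 / 2 + μ * z) - 1))

section Derivs

variable (b σ μ lam δ T : ℝ)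

theorem cumulantC_ofReal (s : ℝ) :
    cumulantC b σ μ lam δ T s = (cumulant b σ μ lam δ T s : ℂ) := by
  simp [cumulantC, cumulant]

theorem hasDerivAt_jumpExponent (s : ℝ) :
    HasDerivAt (fun s : ℝ => Real.exp (δ ^ 2 * s ^ 2 / 2 + μ * s))
      ((δ ^ 2 * s + μ) * Real.exp (δ ^ 2 * s ^ 2 / 2 + μ * s)) s := by
  have h : HasDerivAt (fun s : ℝ => δ ^ 2 * s ^ 2 / 2 + μ * s) (δ ^ 2 * s + μ) s := by
    have := (((hasDerivAt_pow 2 s).const_mul (δ ^ 2)).div_const 2).add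
      ((hasDerivAt_id s).const_mul μ)
    exact this.congr_deriv (by simp; ring)
  exact h.exp.congr_deriv (by ring)

theorem hasDerivAt_cumulant (s : ℝ) :
    HasDerivAt (cumulant b σ μ lam δ T) (cumulantDeriv b σ μ lam δ T s) s := by
  have := (((((hasDerivAt_pow 2 s).const_mul (σ ^ 2)).div_const 2).add
      ((hasDerivAt_id s).const_mul b)).add
      (((hasDerivAt_jumpExponent μ δ s).sub_const 1).const_mul lam)).const_mul T
  exact this.congr_deriv (by rw [cumulantDeriv]; push_cast; ring)

theorem hasDerivAt_cumulantDeriv (s : ℝ) :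
    HasDerivAt (cumulantDeriv b σ μ lam δ T) (cumulantDeriv₂ σ μ lam δ T s) s := by
  have h1 : HasDerivAt (fun s : ℝ => δ ^ 2 * s + μ) (δ ^ 2) s := by
    simpa using ((hasDerivAt_id s).const_mul (δ ^ 2)).add_const μ
  have := ((((hasDerivAt_id s).const_mul (σ ^ 2)).add_const b).add
      ((h1.mul (hasDerivAt_jumpExponent μ δ s)).const_mul lam)).const_mul T
  exact this.congr_deriv (by rw [cumulantDeriv₂]; ring)

theorem deriv_cumulant : deriv (cumulant b σ μ lam δ T) = cumulantDeriv b σ μ lam δ T :=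
  funext fun s => (hasDerivAt_cumulant b σ μ lam δ T s).deriv

theorem iteratedDeriv_two_cumulant :
    iteratedDeriv 2 (cumulant b σ μ lam δ T) = cumulantDeriv₂ σ μ lam δ T := by
  rw [iteratedDeriv_succ, iteratedDeriv_one, deriv_cumulant]
  exact funext fun s => (hasDerivAt_cumulantDeriv b σ μ lam δ T s).deriv

variable {b σ μ lam δ T}

/-- The jump part of the cumulant is convex, so the Brownian part alone gives `m'` slope at least
`Tσ²`. This yields both injectivity and divergence at `±∞`, hence a unique saddle point. -/
theorem monotone_cumulantDeriv_sub (hlam : 0 ≤ lam) (hT : 0 ≤ T) :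
    Monotone (fun s => cumulantDeriv b σ μ lam δ T s - T * σ ^ 2 * s) := by
  have hd : ∀ s, HasDerivAt (fun s => cumulantDeriv b σ μ lam δ T s - T * σ ^ 2 * s)
      (cumulantDeriv₂ σ μ lam δ T s - T * σ ^ 2) s := fun s =>
    ((hasDerivAt_cumulantDeriv b σ μ lam δ T s).sub
      ((hasDerivAt_id s).const_mul (T * σ ^ 2))).congr_deriv (by simp)
  refine monotone_of_deriv_nonneg (fun s => (hd s).differentiableAt) fun s => ?_
  rw [(hd s).deriv, cumulantDeriv₂, mul_add, add_sub_cancel_left]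
  positivity

theorem cumulantDeriv_sub_le (hlam : 0 ≤ lam) (hT : 0 ≤ T) {s t : ℝ} (h : s ≤ t) :
    T * σ ^ 2 * (t - s) ≤ cumulantDeriv b σ μ lam δ T t - cumulantDeriv b σ μ lam δ T s := by
  have := monotone_cumulantDeriv_sub (b := b) (σ := σ) (μ := μ) (δ := δ) hlam hT h
  simp only at this
  linarith

theorem strictMono_cumulantDeriv (hσ : 0 < σ) (hlam : 0 ≤ lam) (hT : 0 < T) :
    StrictMono (cumulantDeriv b σ μ lam δ T) := fun s t h => by
  have := cumulantDeriv_sub_le (b := b) (σ := σ) (μ := μ) (δ := δ) hlam hT.le h.le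
  have : 0 < T * σ ^ 2 * (t - s) := by have := sub_pos.2 h; positivity
  linarith

theorem existsUnique_cumulantDeriv_eq (hσ : 0 < σ) (hlam : 0 ≤ lam) (hT : 0 < T) (k : ℝ) :
    ∃! s, cumulantDeriv b σ μ lam δ T s = k := by
  have hc : Continuous (cumulantDeriv b σ μ lam δ T) :=
    continuous_iff_continuousAt.2 fun s => (hasDerivAt_cumulantDeriv b σ μ lam δ T s).continuousAt
  have ha : 0 < T * σ ^ 2 := by positivity
  have htop : Tendsto (cumulantDeriv b σ μ lam δ T) atTop atTop := by
    have h1 : Tendsto (fun s : ℝ => cumulantDeriv b σ μ lam δ T 0 + T * σ ^ 2 * s) atTop atTop :=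
      tendsto_atTop_add_const_left _ _ (tendsto_id.const_mul_atTop ha)
    refine tendsto_atTop_mono' _ ?_ h1
    filter_upwards [eventually_ge_atTop 0] with s hs
    have := cumulantDeriv_sub_le (b := b) (σ := σ) (μ := μ) (δ := δ) hlam hT.le hs
    linarith
  have hbot : Tendsto (cumulantDeriv b σ μ lam δ T) atBot atBot := by
    have h1 : Tendsto (fun s : ℝ => cumulantDeriv b σ μ lam δ T 0 + T * σ ^ 2 * s) atBot atBot :=
      tendsto_atBot_add_const_left _ _ (tendsto_id.const_mul_atBot ha)
    refine tendsto_atBot_mono' _ ?_ h1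
    filter_upwards [eventually_le_atBot 0] with s hs
    have := cumulantDeriv_sub_le (b := b) (σ := σ) (μ := μ) (δ := δ) hlam hT.le hs
    linarith
  obtain ⟨s, hs⟩ := hc.surjective htop hbot k
  exact ⟨s, hs, fun t ht => (strictMono_cumulantDeriv hσ hlam hT).injective (ht.trans hs.symm)⟩

end Derivs

/-! ### Moment generating function of the log-return -/

section Merton

theorem IsPoissonProcess.hasLaw {Ω : Type*} [MeasurableSpace Ω] {P : Measure Ω}
    {N : ℝ≥0 → Ω → ℕ} {lam : ℝ≥0} (h : IsPoissonProcess N lam P) (t : ℝ≥0) :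
    HasLaw (N t) (poissonMeasure (lam * t)) P := by
  have := h.law_increment 0 t zero_le
  rw [tsub_zero] at this
  refine this.congr ?_
  filter_upwards [h.zero] with ω hω
  simp [hω]

variable {Ω : Type*} [MeasurableSpace Ω] {P : Measure Ω} [IsProbabilityMeasure P]
    {b σ μ : ℝ} {lam δ T : ℝ≥0} {W : ℝ≥0 → Ω → ℝ} {N : ℝ≥0 → Ω → ℕ} {Y : ℕ → Ω → ℝ}

theorem IsMertonNoise.mgf_logReturn (h : IsMertonNoise W N Y lam μ δ P) (b σ : ℝ) (T : ℝ≥0)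
    (s : ℝ) :
    Integrable (fun ω => Real.exp (s * logReturn b σ W N Y T ω)) P ∧
      mgf (logReturn b σ W N Y T) P s = Real.exp (cumulant b σ μ lam δ T s) := by
  have hW := h.brownian.toIsPreBrownianReal.hasLaw_eval T
  have hN := h.poisson.hasLaw T
  have hY : ∀ j, mgf (Y j) P s = Real.exp (μ * s + (δ : ℝ) ^ 2 * s ^ 2 / 2) := fun j => by
    rw [mgf_gaussianReal (h.jump_law j).map_eq]; simp
  have hNY : IndepFun (N T) (fun ω j => Y j ω) P :=
    h.indep_N_Y.comp (φ := fun f : ℝ≥0 → ℕ => f T) (ψ := id) (measurable_pi_apply T) measurable_id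
  obtain ⟨hSi, hSm⟩ := compoundPoisson_exp_moment hN (fun j => (h.jump_law j).aemeasurable)
    h.jump_indep hNY (Real.exp_pos _) hY
  have hind : IndepFun (fun ω => b * T + σ * W T ω)
      (fun ω => ∑ j ∈ Finset.range (N T ω), Y j ω) P := by
    refine h.indep_W_NY.comp (φ := fun w : ℝ≥0 → ℝ => b * T + σ * w T)
      (ψ := fun p : (ℝ≥0 → ℕ) × (ℕ → ℝ) => ∑ j ∈ Finset.range (p.1 T), p.2 j)
      (by fun_prop) ?_
    exact measurable_sum_range_pi.comp (f := fun p : (ℝ≥0 → ℕ) × (ℕ → ℝ) => (p.1 T, p.2))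
      (((measurable_pi_apply T).comp measurable_fst).prodMk measurable_snd)
  have hWm : mgf (fun ω => b * T + σ * W T ω) P s
      = Real.exp (T * (σ ^ 2 * s ^ 2 / 2 + b * s)) := by
    have h1 := mgf_gaussianReal hW.map_eq (s * σ)
    simp only [mgf] at h1 ⊢
    have : ∀ ω, Real.exp (s * (b * T + σ * W T ω))
        = Real.exp (s * b * T) * Real.exp (s * σ * W T ω) := fun ω => by
      rw [← Real.exp_add]; ring_nf
    simp_rw [this]
    rw [integral_const_mul, h1, ← Real.exp_add]
    congr 1; ring
  have hWi : Integrable (fun ω => Real.exp (s * (b * T + σ * W T ω))) P := by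
    rw [← mgf_pos_iff (X := fun ω => b * T + σ * W T ω), hWm]
    exact Real.exp_pos _
  refine ⟨hind.integrable_exp_mul_add hWi hSi, ?_⟩
  have := hind.mgf_add hWi.aestronglyMeasurable hSi.aestronglyMeasurable
  change mgf ((fun ω => b * T + σ * W T ω) + fun ω => ∑ j ∈ Finset.range (N T ω), Y j ω) P s = _
  rw [this, hWm, hSm, ← Real.exp_add, cumulant]
  congr 1
  push_cast
  ring_nf

end Merton

/-! ### Extension to complex arguments -/

section Entire

variable {Ω : Type*} [MeasurableSpace Ω] {P : Measure Ω} {X : Ω → ℝ} {b σ μ lam δ T : ℝ}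

theorem cgf_eq_cumulant (hm : ∀ s, mgf X P s = Real.exp (cumulant b σ μ lam δ T s)) :
    cgf X P = cumulant b σ μ lam δ T :=
  funext fun s => by rw [cgf, hm, Real.log_exp]

/-- Both sides are entire and agree on the real axis, which accumulates at `0`; the identity theorem
does the rest. -/
theorem complexMGF_eq_exp_cumulantC (hi : ∀ s : ℝ, Integrable (fun ω => Real.exp (s * X ω)) P)
    (hm : ∀ s, mgf X P s = Real.exp (cumulant b σ μ lam δ T s)) (z : ℂ) :
    complexMGF X P z = Complex.exp (cumulantC b σ μ lam δ T z) := by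
  have huniv : integrableExpSet X P = Set.univ := Set.eq_univ_of_forall hi
  have h1 : AnalyticOnNhd ℂ (complexMGF X P) Set.univ := by
    simpa [huniv] using analyticOnNhd_complexMGF (X := X) (μ := P)
  have h2 : AnalyticOnNhd ℂ (fun z => Complex.exp (cumulantC b σ μ lam δ T z)) Set.univ := by
    refine DifferentiableOn.analyticOnNhd (Differentiable.differentiableOn ?_) isOpen_univ
    unfold cumulantC
    fun_prop
  have h3 : ∃ᶠ z in 𝓝[≠] (0 : ℂ),
      complexMGF X P z = Complex.exp (cumulantC b σ μ lam δ T z) := by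
    have ht : Tendsto (fun x : ℝ => (x : ℂ)) (𝓝[≠] 0) (𝓝[≠] 0) := by
      refine tendsto_nhdsWithin_iff.2 ⟨?_, ?_⟩
      · exact (Complex.continuous_ofReal.tendsto' 0 0 Complex.ofReal_zero).mono_left
          nhdsWithin_le_nhds
      · filter_upwards [self_mem_nhdsWithin] with x hx
        simpa using hx
    refine ht.frequently (Frequently.of_forall fun x => ?_)
    rw [complexMGF_ofReal, hm, cumulantC_ofReal, Complex.ofReal_exp]
  exact h1.eqOn_of_preconnected_of_frequently_eq h2 isPreconnected_univ (Set.mem_univ _) h3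
    (Set.mem_univ z)

end Entire

end MertonModel

namespace MertonModel

/-! ### Fourier representation of the call price -/

section Fourier

open Complex (I)
open scoped FourierTransform

/-- The Fourier kernel of the damped call payoff. -/
noncomputable def callKernel (s t : ℝ) : ℂ := ((s - 1 + t * I) * (s + t * I))⁻¹

theorem sub_one_add_mul_I_ne_zero {s : ℝ} (hs : 2 ≤ s) (t : ℝ) : (s - 1 + t * I : ℂ) ≠ 0 := by
  intro h
  have := congrArg Complex.re h
  simp at this
  linarith

theorem add_mul_I_ne_zero {s : ℝ} (hs : 2 ≤ s) (t : ℝ) : (s + t * I : ℂ) ≠ 0 := by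
  intro h
  have := congrArg Complex.re h
  simp at this
  linarith

theorem continuous_callKernel {s : ℝ} (hs : 2 ≤ s) : Continuous (callKernel s) := by
  unfold callKernel
  refine Continuous.inv₀ (by fun_prop) fun t =>
    mul_ne_zero (sub_one_add_mul_I_ne_zero hs t) (add_mul_I_ne_zero hs t)

theorem sqrt_one_add_sq_le_norm {a t : ℝ} (ha : 1 ≤ a) : √(1 + t ^ 2) ≤ ‖(a + t * I : ℂ)‖ := by
  rw [Complex.norm_add_mul_I]
  exact Real.sqrt_le_sqrt (by nlinarith)

/-- For `s ≥ 2` both poles stay at distance at least `1` from the line of integration, so the bound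
is uniform in `s`. The quadratic decay makes the inversion integral absolutely convergent. -/
theorem norm_callKernel_le {s : ℝ} (hs : 2 ≤ s) (t : ℝ) : ‖callKernel s t‖ ≤ (1 + t ^ 2)⁻¹ := by
  have h1 := sqrt_one_add_sq_le_norm (a := s - 1) (t := t) (by linarith)
  have h2 := sqrt_one_add_sq_le_norm (a := s) (t := t) (by linarith)
  push_cast at h1
  have h0 : 0 ≤ √(1 + t ^ 2) := Real.sqrt_nonneg _
  rw [callKernel, norm_inv, norm_mul]
  refine inv_anti₀ (by positivity) ?_
  calc 1 + t ^ 2 = √(1 + t ^ 2) * √(1 + t ^ 2) := (Real.mul_self_sqrt (by positivity)).symm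
    _ ≤ _ := by gcongr

theorem integrable_callKernel {s : ℝ} (hs : 2 ≤ s) : Integrable (callKernel s) :=
  integrable_inv_one_add_sq.mono' (continuous_callKernel hs).aestronglyMeasurable
    (.of_forall fun t => norm_callKernel_le hs t)

/-- The call payoff damped by `e^{-sy}`. -/
noncomputable def dampedCall (s y : ℝ) : ℝ := Real.exp (-s * y) * max (Real.exp y - 1) 0

theorem dampedCall_eq_indicator (s : ℝ) :
    (fun y => (dampedCall s y : ℂ)) = (Set.Ioi (0 : ℝ)).indicator
      (fun y : ℝ => Complex.exp (-(s - 1 : ℂ) * y) - Complex.exp (-(s : ℂ) * y)) := by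
  funext y
  by_cases hy : 0 < y
  · rw [Set.indicator_of_mem (Set.mem_Ioi.2 hy), dampedCall, max_eq_left]
    · push_cast
      rw [mul_sub, ← Complex.exp_add]
      ring_nf
    · have := Real.one_le_exp hy.le
      linarith
  · rw [Set.indicator_of_notMem (by simpa using hy), dampedCall, max_eq_right]
    · simp
    · have := Real.exp_le_one_iff.2 (not_lt.1 hy)
      linarith

theorem continuous_dampedCall (s : ℝ) : Continuous (fun y => (dampedCall s y : ℂ)) := by
  unfold dampedCall
  fun_prop

theorem integrable_dampedCall {s : ℝ} (hs : 2 ≤ s) :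
    Integrable (fun y => (dampedCall s y : ℂ)) := by
  rw [dampedCall_eq_indicator, integrable_indicator_iff measurableSet_Ioi]
  refine Integrable.sub (integrableOn_exp_mul_complex_Ioi ?_ 0)
    (integrableOn_exp_mul_complex_Ioi ?_ 0)
  · simp; linarith
  · simp; linarith

theorem fourier_dampedCall {s : ℝ} (hs : 2 ≤ s) (ξ : ℝ) :
    𝓕 (fun y => (dampedCall s y : ℂ)) ξ = callKernel s (2 * Real.pi * ξ) := by
  rw [Real.fourier_real_eq_integral_exp_smul]
  simp_rw [fun v => congrFun (dampedCall_eq_indicator s) v]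
  have h1 := sub_one_add_mul_I_ne_zero hs (2 * Real.pi * ξ)
  have h2 := add_mul_I_ne_zero hs (2 * Real.pi * ξ)
  have r1 : (-(s - 1 + (2 * Real.pi * ξ : ℝ) * I : ℂ)).re < 0 := by simp; linarith
  have r2 : (-(s + (2 * Real.pi * ξ : ℝ) * I : ℂ)).re < 0 := by simp; linarith
  calc _ = ∫ v in Set.Ioi (0 : ℝ),
        (Complex.exp (-(s - 1 + (2 * Real.pi * ξ : ℝ) * I : ℂ) * v)
          - Complex.exp (-(s + (2 * Real.pi * ξ : ℝ) * I : ℂ) * v)) := by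
        rw [← integral_indicator measurableSet_Ioi]
        congr 1
        funext v
        by_cases hv : v ∈ Set.Ioi (0 : ℝ)
        · simp only [Set.indicator_of_mem hv, smul_eq_mul, mul_sub, ← Complex.exp_add]
          push_cast
          ring_nf
        · simp only [Set.indicator_of_notMem hv, smul_zero]
    _ = _ := by
        rw [integral_sub (integrableOn_exp_mul_complex_Ioi r1 0)
          (integrableOn_exp_mul_complex_Ioi r2 0), integral_exp_mul_complex_Ioi r1,
          integral_exp_mul_complex_Ioi r2, callKernel]
        simp only [Complex.ofReal_zero, mul_zero, Complex.exp_zero]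
        field_simp
        ring

/-- Pointwise Fourier inversion: the damped payoff is continuous and integrable with integrable
transform. The factor `2π` comes from rescaling the frequency. -/
theorem integral_exp_mul_callKernel {s : ℝ} (hs : 2 ≤ s) (y : ℝ) :
    ∫ t : ℝ, Complex.exp (t * y * I) * callKernel s t = 2 * Real.pi * dampedCall s y := by
  have hpi : (0 : ℝ) < 2 * Real.pi := by positivity
  have hF : 𝓕 (fun y => (dampedCall s y : ℂ)) = fun ξ => callKernel s (2 * Real.pi * ξ) :=
    funext fun ξ => fourier_dampedCall hs ξ
  have h := congrFun ((continuous_dampedCall s).fourierInv_fourier_eq (integrable_dampedCall hs)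
    (by rw [hF]; exact (integrable_callKernel hs).comp_mul_left' hpi.ne')) y
  rw [hF, Real.fourierInv_eq'] at h
  simp only [RCLike.inner_apply, conj_trivial, smul_eq_mul] at h
  have h2 := Measure.integral_comp_mul_left
    (fun t : ℝ => Complex.exp (t * y * I) * callKernel s t) (2 * Real.pi)
  rw [← h]
  have h3 : ∀ v : ℝ, Complex.exp (((2 * Real.pi * (y * v) : ℝ) : ℂ) * I)
        * callKernel s (2 * Real.pi * v)
      = Complex.exp ((2 * Real.pi * v : ℝ) * y * I) * callKernel s (2 * Real.pi * v) := fun v => by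
    push_cast; ring_nf
  simp_rw [h3]
  rw [h2, abs_of_pos (by positivity)]
  rw [Complex.real_smul]
  push_cast
  field_simp
  simp only [mul_comm, mul_left_comm]

theorem callPayoff_eq_dampedCall (k s x : ℝ) :
    callPayoff k x = Real.exp (k * (1 - s)) * (Real.exp (s * x) * dampedCall s (x - k)) := by
  have h : Real.exp x - Real.exp k = Real.exp k * (Real.exp (x - k) - 1) := by
    rw [mul_sub, ← Real.exp_add]; ring_nf
  have h2 : max (Real.exp k * (Real.exp (x - k) - 1)) 0
      = Real.exp k * max (Real.exp (x - k) - 1) 0 := by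
    rw [mul_max_of_nonneg _ _ (Real.exp_pos k).le, mul_zero]
  rw [callPayoff, dampedCall, h, h2]
  simp only [← mul_assoc, ← Real.exp_add]
  ring_nf

variable {Ω : Type*} [MeasurableSpace Ω] {P : Measure Ω} {X : Ω → ℝ}

/-- `X` is the logarithm of `exp (1 * X)`. -/
theorem aemeasurable_of_integrable_exp
    (hi : ∀ s : ℝ, Integrable (fun ω => Real.exp (s * X ω)) P) : AEMeasurable X P := by
  have := Real.measurable_log.comp_aemeasurable (hi 1).aemeasurable
  simpa [Function.comp_def] using this

theorem integrable_callPayoff (hi : ∀ s : ℝ, Integrable (fun ω => Real.exp (s * X ω)) P)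
    (k : ℝ) : Integrable (fun ω => callPayoff k (X ω)) P := by
  have hX := aemeasurable_of_integrable_exp hi
  refine (hi 1).mono' (AEMeasurable.aestronglyMeasurable ?_) (.of_forall fun ω => ?_)
  · unfold callPayoff; fun_prop
  · rw [callPayoff, Real.norm_eq_abs, abs_of_nonneg (le_max_right _ _), one_mul]
    exact max_le (by linarith [Real.exp_pos k]) (Real.exp_pos _).le

/-- The call price as a Fourier integral of the moment generating function. -/
theorem callPrice_eq_integral [IsFiniteMeasure P]
    (hi : ∀ s : ℝ, Integrable (fun ω => Real.exp (s * X ω)) P) {s : ℝ} (hs : 2 ≤ s) (k : ℝ) :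
    (2 * Real.pi * callPrice X P k : ℂ) = Real.exp (k * (1 - s)) *
      ∫ t : ℝ, complexMGF X P (s + t * I) * Complex.exp (-(t * k * I)) * callKernel s t := by
  have hX := aemeasurable_of_integrable_exp hi
  -- Fubini: an integrable function of `ω` times an integrable function of `t`, times a factor of
  -- modulus `1`.
  have hint : Integrable (fun p : Ω × ℝ => ((Real.exp (s * X p.1) : ℂ) * callKernel s p.2) *
      Complex.exp (p.2 * ((X p.1 - k : ℝ) : ℂ) * I)) (P.prod volume) := by
    refine ((hi s).ofReal.mul_prod (integrable_callKernel hs)).mul_bdd (c := 1) ?_ ?_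
    · refine AEMeasurable.aestronglyMeasurable ?_
      have h1 : AEMeasurable (fun p : Ω × ℝ => X p.1) (P.prod volume) := hX.comp_fst
      fun_prop
    · refine .of_forall fun p => ?_
      rw [← Complex.ofReal_mul, Complex.norm_exp_ofReal_mul_I]
  have hswap := integral_integral_swap (f := fun (ω : Ω) (t : ℝ) =>
    ((Real.exp (s * X ω) : ℂ) * callKernel s t) * Complex.exp (t * ((X ω - k : ℝ) : ℂ) * I)) hint
  have hL : ∀ ω, ∫ t : ℝ, ((Real.exp (s * X ω) : ℂ) * callKernel s t) *
      Complex.exp (t * ((X ω - k : ℝ) : ℂ) * I)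
      = ((2 * Real.pi * (Real.exp (s * X ω) * dampedCall s (X ω - k)) : ℝ) : ℂ) := fun ω => by
    have := integral_exp_mul_callKernel hs (X ω - k)
    have h2 : ∀ t : ℝ, ((Real.exp (s * X ω) : ℂ) * callKernel s t) *
      Complex.exp (t * ((X ω - k : ℝ) : ℂ) * I) = (Real.exp (s * X ω) : ℂ) *
        (Complex.exp (t * ((X ω - k : ℝ) : ℂ) * I) * callKernel s t) := fun t => by ring
    simp_rw [h2]
    rw [integral_const_mul, this]
    push_cast
    ring
  have hR : ∀ t : ℝ, ∫ ω, ((Real.exp (s * X ω) : ℂ) * callKernel s t) *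
      Complex.exp (t * ((X ω - k : ℝ) : ℂ) * I) ∂P
      = complexMGF X P (s + t * I) * Complex.exp (-(t * k * I)) * callKernel s t := fun t => by
    have h2 : ∀ ω, ((Real.exp (s * X ω) : ℂ) * callKernel s t) *
      Complex.exp (t * ((X ω - k : ℝ) : ℂ) * I)
       = Complex.exp ((s + t * I) * X ω) * (Complex.exp (-(t * k * I)) * callKernel s t) := by
      intro ω
      have : Complex.exp ((s + t * I) * X ω) * Complex.exp (-(t * k * I))
          = (Real.exp (s * X ω) : ℂ) * Complex.exp (t * ((X ω - k : ℝ) : ℂ) * I) := by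
        rw [Complex.ofReal_exp, ← Complex.exp_add, ← Complex.exp_add]
        push_cast
        ring_nf
      rw [← mul_assoc, this]; ring
    simp_rw [h2]
    rw [integral_mul_const, complexMGF, ← mul_assoc]
  simp_rw [hL, hR] at hswap
  rw [← hswap, integral_complex_ofReal, callPrice]
  simp_rw [callPayoff_eq_dampedCall k s]
  rw [integral_const_mul, integral_const_mul]
  push_cast
  ring

end Fourier

end MertonModel

namespace MertonModel

open Complex (I)

/-! ### Absolute Gaussian moments -/

section GaussianMoments

theorem integrable_abs_pow_mul_exp_neg_mul_sq {a : ℝ} (ha : 0 < a) (n : ℕ) :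
    Integrable (fun t : ℝ => |t| ^ n * Real.exp (-a * t ^ 2)) := by
  have h := (integrable_rpow_mul_exp_neg_mul_sq ha (s := n) (by
    have : (0 : ℝ) ≤ n := n.cast_nonneg
    linarith)).norm
  refine h.congr (.of_forall fun t => ?_)
  simp [abs_of_pos (Real.exp_pos _)]

theorem integral_abs_pow_mul_exp_neg_mul_sq {a : ℝ} (ha : 0 < a) (n : ℕ) :
    ∫ t : ℝ, |t| ^ (2 * n + 1) * Real.exp (-a * t ^ 2) = n.factorial / a ^ (n + 1) := by
  have h1 := integral_comp_abs (f := fun t : ℝ => t ^ (2 * n + 1) * Real.exp (-a * t ^ 2))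
  simp only [sq_abs] at h1
  have h2 := integral_rpow_mul_exp_neg_mul_rpow (p := 2) (q := (2 * n + 1 : ℕ)) (b := a)
    (by norm_num) (by have : (0 : ℝ) ≤ (2 * n + 1 : ℕ) := Nat.cast_nonneg _
                      linarith) ha
  simp only [Real.rpow_natCast, Real.rpow_ofNat] at h2
  have e : (((2 * n + 1 : ℕ) : ℝ) + 1) / 2 = n + 1 := by push_cast; ring
  rw [h1, h2, neg_div, e, Real.Gamma_nat_eq_factorial, Real.rpow_neg ha.le]
  rw [show (n : ℝ) + 1 = (n + 1 : ℕ) by push_cast; rfl, Real.rpow_natCast]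
  field_simp

end GaussianMoments

/-! ### Gaussian approximation of the tilted characteristic function -/

section Exponent

/-- Mean value inequality on the convex half-plane `re z ≤ M`, where the derivative of `exp` has
norm at most `e^M`. -/
theorem norm_exp_sub_exp_le {a b : ℂ} {M : ℝ} (ha : a.re ≤ M) (hb : b.re ≤ M) :
    ‖Complex.exp a - Complex.exp b‖ ≤ Real.exp M * ‖a - b‖ := by
  refine Convex.norm_image_sub_le_of_norm_hasDerivWithin_le (s := {z : ℂ | z.re ≤ M})
    (f := Complex.exp) (f' := Complex.exp) (fun z _ => (Complex.hasDerivAt_exp z).hasDerivWithinAt)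
    (fun z hz => ?_) (convex_halfSpace_re_le M) hb ha
  rw [Complex.norm_exp]
  exact Real.exp_le_exp.2 hz

/-- Taylor's bound for `‖w‖ ≤ 1`; beyond that each of the four terms is at most `‖w‖ ^ 3`, because
`re w ≤ 0` gives `‖exp w‖ ≤ 1`. -/
theorem norm_exp_sub_quadratic_le {w : ℂ} (hw : w.re ≤ 0) :
    ‖Complex.exp w - 1 - w - w ^ 2 / 2‖ ≤ 4 * ‖w‖ ^ 3 := by
  rcases le_total ‖w‖ 1 with h | h
  · have := Complex.exp_bound (x := w) h (n := 3) (by norm_num)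
    simp only [Finset.sum_range_succ, Finset.sum_range_zero] at this
    norm_num [Nat.factorial] at this
    have e : Complex.exp w - 1 - w - w ^ 2 / 2 = Complex.exp w - (1 + w + w ^ 2 / 2) := by ring
    rw [e]
    have : 0 ≤ ‖w‖ ^ 3 := by positivity
    linarith
  · have h1 : ‖Complex.exp w‖ ≤ 1 := by
      rw [Complex.norm_exp]; exact Real.exp_le_one_iff.2 hw
    have h2 : ‖w ^ 2 / 2‖ = ‖w‖ ^ 2 / 2 := by simp
    have h3 : ‖Complex.exp w - 1 - w - w ^ 2 / 2‖
        ≤ ‖Complex.exp w‖ + ‖(1 : ℂ)‖ + ‖w‖ + ‖w ^ 2 / 2‖ :=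
      (norm_sub_le _ _).trans (by gcongr; exact (norm_sub_le _ _).trans (by
        gcongr; exact norm_sub_le _ _))
    rw [h2, norm_one] at h3
    have h4 : ‖w‖ ≤ ‖w‖ ^ 3 := le_self_pow₀ h (by norm_num)
    have h5 : ‖w‖ ^ 2 ≤ ‖w‖ ^ 3 := pow_le_pow_right₀ h (by norm_num)
    linarith

/-- The logarithm of the characteristic function of the centred, exponentially tilted log-return:
`v` is the Brownian variance, `r` the tilted intensity, `h` and `d ^ 2` mean and variance of the
tilted jumps. -/
noncomputable def tiltedExponent (d v r h t : ℝ) : ℂ :=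
  -(v * t ^ 2 / 2) + r * (Complex.exp (h * t * I - d ^ 2 * t ^ 2 / 2) - 1 - h * t * I)

variable {d v r h : ℝ}

/-- With `w = iht - d²t²/2`, the quadratic part of `w + w²/2` produces exactly the variance. What is
left is of order three and four in `t`, and `|t| ≤ 1 ≤ h` absorbs all of it into `h³|t|³`. -/
theorem tiltedExponent_add_le (hr : 0 ≤ r) (hh : 1 ≤ h) {t : ℝ} (ht : |t| ≤ 1) :
    ‖tiltedExponent d v r h t - ((-((v + r * (h ^ 2 + d ^ 2)) * t ^ 2 / 2) : ℝ) : ℂ)‖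
      ≤ (4 * (1 + d ^ 2) ^ 3 + d ^ 2 + d ^ 4) * (r * h ^ 3 * |t| ^ 3) := by
  set w : ℂ := h * t * I - d ^ 2 * t ^ 2 / 2 with hw
  have hre : w.re = -(d ^ 2 * t ^ 2 / 2) := by
    simp [hw, ← Complex.ofReal_pow, ← Complex.ofReal_mul]
  have hwn : ‖w‖ ≤ (1 + d ^ 2) * (h * |t|) := by
    have h1 : ‖w‖ ≤ ‖(h * t * I : ℂ)‖ + ‖(d ^ 2 * t ^ 2 / 2 : ℂ)‖ := norm_sub_le _ _
    have h2 : ‖(h * t * I : ℂ)‖ = h * |t| := by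
      simp [abs_of_pos (by linarith : (0 : ℝ) < h)]
    have h3 : ‖(d ^ 2 * t ^ 2 / 2 : ℂ)‖ = d ^ 2 * |t| ^ 2 / 2 := by simp
    rw [h2, h3] at h1
    have h4 : |t| ^ 2 ≤ |t| := by
      have := abs_nonneg t
      nlinarith
    have h5 : |t| ≤ h * |t| := le_mul_of_one_le_left (abs_nonneg t) hh
    have : d ^ 2 * |t| ^ 2 ≤ d ^ 2 * (h * |t|) := by gcongr; linarith
    have : 0 ≤ d ^ 2 * |t| ^ 2 := by positivity
    linarith
  have hexp := norm_exp_sub_quadratic_le (w := w) (by rw [hre, neg_nonpos]; positivity)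
  have e : tiltedExponent d v r h t - ((-((v + r * (h ^ 2 + d ^ 2)) * t ^ 2 / 2) : ℝ) : ℂ)
      = r * ((Complex.exp w - 1 - w - w ^ 2 / 2)
          + (-(h * d ^ 2 * t ^ 3 / 2) * I + d ^ 4 * t ^ 4 / 8)) := by
    rw [tiltedExponent, ← hw]
    have hsq : w ^ 2 = -(h ^ 2 * t ^ 2) - h * d ^ 2 * t ^ 3 * I + d ^ 4 * t ^ 4 / 4 := by
      rw [hw]
      linear_combination (h ^ 2 * t ^ 2 : ℂ) * Complex.I_sq
    rw [hsq]
    have : (h * t * I : ℂ) = w + d ^ 2 * t ^ 2 / 2 := by rw [hw]; ring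
    rw [this]
    push_cast
    ring
  have h6 : ‖(-(h * d ^ 2 * t ^ 3 / 2) * I + d ^ 4 * t ^ 4 / 8 : ℂ)‖
      ≤ (d ^ 2 + d ^ 4) * (h ^ 3 * |t| ^ 3) := by
    refine (norm_add_le _ _).trans ?_
    have h2 : ‖(-(h * d ^ 2 * t ^ 3 / 2) * I : ℂ)‖ = h * d ^ 2 * |t| ^ 3 / 2 := by
      simp [abs_of_pos (by linarith : (0 : ℝ) < h)]
    have h3 : ‖(d ^ 4 * t ^ 4 / 8 : ℂ)‖ = d ^ 4 * |t| ^ 4 / 8 := by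
      simp [show |d| ^ 4 = d ^ 4 from Even.pow_abs ⟨2, rfl⟩ d]
    rw [h2, h3]
    have h4 : h ≤ h ^ 3 := le_self_pow₀ hh (by norm_num)
    have h5 : |t| ^ 4 ≤ |t| ^ 3 := pow_le_pow_of_le_one (abs_nonneg t) ht (by norm_num)
    have h7 : |t| ^ 4 ≤ h ^ 3 * |t| ^ 3 :=
      h5.trans (le_mul_of_one_le_left (by positivity) (one_le_pow₀ hh))
    have h8 : h * |t| ^ 3 ≤ h ^ 3 * |t| ^ 3 := by gcongr
    have h9 : d ^ 2 * (h * |t| ^ 3) ≤ d ^ 2 * (h ^ 3 * |t| ^ 3) := by gcongr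
    have h10 : d ^ 4 * |t| ^ 4 ≤ d ^ 4 * (h ^ 3 * |t| ^ 3) := by gcongr
    have h11 : 0 ≤ d ^ 2 * (h * |t| ^ 3) := by positivity
    have h12 : 0 ≤ d ^ 4 * |t| ^ 4 := by positivity
    linarith
  rw [e, norm_mul, Complex.norm_real, Real.norm_of_nonneg hr]
  calc r * _ ≤ r * (4 * ((1 + d ^ 2) * (h * |t|)) ^ 3 + (d ^ 2 + d ^ 4) * (h ^ 3 * |t| ^ 3)) := by
        gcongr
        exact (norm_add_le _ _).trans (add_le_add (hexp.trans (by gcongr)) h6)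
    _ = _ := by ring

theorem one_sub_exp_neg_ge {x : ℝ} (hx : 0 ≤ x) : x / (1 + x) ≤ 1 - Real.exp (-x) := by
  have h1 : Real.exp (-x) ≤ (1 + x)⁻¹ := by
    rw [Real.exp_neg]
    exact inv_anti₀ (by positivity) (by linarith [Real.add_one_le_exp x])
  have h2 : x / (1 + x) = 1 - (1 + x)⁻¹ := by field_simp; ring
  linarith

/-- Bounding the cosine by `1` keeps only the damping due to the jump variance, which makes the
estimate independent of the growing mean `h`. -/
theorem tiltedExponent_re_le (hr : 0 ≤ r) (t : ℝ) :
    (tiltedExponent d v r h t).re ≤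
      -(v * t ^ 2 / 2) - r * (1 - Real.exp (-(d ^ 2 * t ^ 2 / 2))) := by
  have e : (tiltedExponent d v r h t).re = -(v * t ^ 2 / 2)
      + r * (Real.exp (-(d ^ 2 * t ^ 2 / 2)) * Real.cos (h * t) - 1) := by
    have hw : (h * t * I - d ^ 2 * t ^ 2 / 2 : ℂ)
        = ((-(d ^ 2 * t ^ 2 / 2) : ℝ) : ℂ) + ((h * t : ℝ) : ℂ) * I := by push_cast; ring
    have hv : (-(v * t ^ 2 / 2) : ℂ) = ((-(v * t ^ 2 / 2) : ℝ) : ℂ) := by push_cast; ring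
    have hz : (h * t * I : ℂ) = ((h * t : ℝ) : ℂ) * I := by push_cast; ring
    rw [tiltedExponent, hw, hv, hz]
    generalize -(d ^ 2 * t ^ 2 / 2) = x, -(v * t ^ 2 / 2) = u, h * t = y
    simp [Complex.exp_re]
  rw [e]
  have := mul_le_mul_of_nonneg_left (mul_le_of_le_one_right
    (Real.exp_pos (-(d ^ 2 * t ^ 2 / 2))).le (Real.cos_le_one (h * t))) hr
  linarith

/-- The rate `d²/(2+d²)` is `x/(1+x)` at `x = d²t²/2`, with `t² ≤ 1` used in the denominator; the
Brownian term is dropped. -/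
theorem tiltedExponent_re_le_of_abs_le (hv : 0 ≤ v) (hr : 0 ≤ r) {t : ℝ} (ht : |t| ≤ 1) :
    (tiltedExponent d v r h t).re ≤ -(d ^ 2 / (2 + d ^ 2) * r) * t ^ 2 := by
  refine (tiltedExponent_re_le hr t).trans ?_
  have ht2 : t ^ 2 ≤ 1 := by rw [← sq_abs]; exact pow_le_one₀ (abs_nonneg t) ht
  have h1 := one_sub_exp_neg_ge (x := d ^ 2 * t ^ 2 / 2) (by positivity)
  have h2 : d ^ 2 / (2 + d ^ 2) * t ^ 2 ≤ d ^ 2 * t ^ 2 / 2 / (1 + d ^ 2 * t ^ 2 / 2) := by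
    have e1 : d ^ 2 * t ^ 2 / 2 / (1 + d ^ 2 * t ^ 2 / 2) = d ^ 2 * t ^ 2 / (2 + d ^ 2 * t ^ 2) := by
      field_simp
    rw [e1, div_mul_eq_mul_div]
    gcongr
    nlinarith [sq_nonneg d]
  have h3 := mul_le_mul_of_nonneg_left (h2.trans h1) hr
  have : 0 ≤ v * t ^ 2 := by positivity
  linarith

/-- In the tails the jumps give only a constant factor `e^{-cr}`, `c = d²/(2+d²)`; the decay in `t`
must come from the Brownian part. -/
theorem tiltedExponent_re_le_of_le_abs (hr : 0 ≤ r) {t : ℝ} (ht : 1 ≤ |t|) :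
    (tiltedExponent d v r h t).re ≤ -(d ^ 2 / (2 + d ^ 2) * r) + -(v / 2) * t ^ 2 := by
  refine (tiltedExponent_re_le hr t).trans ?_
  have ht2 : 1 ≤ t ^ 2 := by rw [← sq_abs]; exact one_le_pow₀ ht
  have h1 := one_sub_exp_neg_ge (x := d ^ 2 / 2) (by positivity)
  have e1 : d ^ 2 / 2 / (1 + d ^ 2 / 2) = d ^ 2 / (2 + d ^ 2) := by field_simp
  rw [e1] at h1
  have h2 : Real.exp (-(d ^ 2 * t ^ 2 / 2)) ≤ Real.exp (-(d ^ 2 / 2)) := by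
    refine Real.exp_le_exp.2 ?_
    nlinarith [sq_nonneg d]
  have h3 := mul_le_mul_of_nonneg_left (h1.trans (sub_le_sub_left h2 1)) hr
  linarith

/-- Pointwise comparison of the tilted characteristic function with its Gaussian approximation. -/
theorem norm_tilted_sub_gaussian_le (hv : 0 ≤ v) (hr : 0 ≤ r) (hh : 1 ≤ h) {p : ℂ} {t : ℝ}
    (hp : ‖p‖ ≤ 1) (hp1 : ‖p - 1‖ ≤ 2 * |t|) :
    ‖Complex.exp (tiltedExponent d v r h t) * p
        - ((Real.exp (-((v + r * (h ^ 2 + d ^ 2)) / 2) * t ^ 2) : ℝ) : ℂ)‖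
      ≤ (4 * (1 + d ^ 2) ^ 3 + d ^ 2 + d ^ 4) * (r * h ^ 3) *
          (|t| ^ 3 * Real.exp (-(d ^ 2 / (2 + d ^ 2) * r) * t ^ 2))
        + 3 * (|t| ^ 1 * Real.exp (-(d ^ 2 / (2 + d ^ 2) * r) * t ^ 2))
        + Real.exp (-(d ^ 2 / (2 + d ^ 2) * r)) * Real.exp (-(v / 2) * t ^ 2) := by
  set c := d ^ 2 / (2 + d ^ 2) with hc
  set K := 4 * (1 + d ^ 2) ^ 3 + d ^ 2 + d ^ 4 with hK
  set a := tiltedExponent d v r h t with ha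
  have hK0 : 0 ≤ K := by positivity
  -- The limiting Gaussian also decays at the rate `c * r`, so one exponential dominates both sides
  -- of the comparison.
  have hB : -((v + r * (h ^ 2 + d ^ 2)) / 2) * t ^ 2 ≤ -(c * r) * t ^ 2 := by
    have h1 : c ≤ (h ^ 2 + d ^ 2) / 2 := by
      have h1 : c ≤ d ^ 2 / 2 := by rw [hc]; gcongr; nlinarith [sq_nonneg d]
      nlinarith
    have h2 := mul_le_mul_of_nonneg_left h1 hr
    have h3 : c * r ≤ (v + r * (h ^ 2 + d ^ 2)) / 2 := by linarith
    have := mul_le_mul_of_nonneg_right h3 (sq_nonneg t)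
    linarith
  have he : ‖Complex.exp a‖ = Real.exp a.re := Complex.norm_exp a
  have hg : ‖((Real.exp (-((v + r * (h ^ 2 + d ^ 2)) / 2) * t ^ 2) : ℝ) : ℂ)‖
      ≤ Real.exp (-(c * r) * t ^ 2) := by
    rw [Complex.norm_real, Real.norm_of_nonneg (Real.exp_pos _).le]
    exact Real.exp_le_exp.2 hB
  rcases le_total |t| 1 with ht | ht
  · have hre := tiltedExponent_re_le_of_abs_le (d := d) (h := h) hv hr ht
    have h1 : ‖Complex.exp a * p - Complex.exp a‖ ≤ Real.exp (-(c * r) * t ^ 2) * (2 * |t|) := by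
      have : Complex.exp a * p - Complex.exp a = Complex.exp a * (p - 1) := by ring
      rw [this, norm_mul, he]
      gcongr
    have h2 : ‖Complex.exp a - ((Real.exp (-((v + r * (h ^ 2 + d ^ 2)) / 2) * t ^ 2) : ℝ) : ℂ)‖
        ≤ Real.exp (-(c * r) * t ^ 2) * (K * (r * h ^ 3 * |t| ^ 3)) := by
      rw [Complex.ofReal_exp]
      refine (norm_exp_sub_exp_le hre (by rw [Complex.ofReal_re]; exact hB)).trans ?_
      gcongr
      rw [show -((v + r * (h ^ 2 + d ^ 2)) / 2) * t ^ 2 = -((v + r * (h ^ 2 + d ^ 2)) * t ^ 2 / 2) by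
        ring]
      exact tiltedExponent_add_le hr hh ht
    have h3 := norm_sub_le_norm_sub_add_norm_sub (Complex.exp a * p) (Complex.exp a)
      ((Real.exp (-((v + r * (h ^ 2 + d ^ 2)) / 2) * t ^ 2) : ℝ) : ℂ)
    have h4 : 0 ≤ |t| * Real.exp (-(c * r) * t ^ 2) := by positivity
    have h5 : 0 ≤ Real.exp (-(c * r)) * Real.exp (-(v / 2) * t ^ 2) := by positivity
    linarith
  · have hre := tiltedExponent_re_le_of_le_abs (d := d) (h := h) (v := v) hr ht
    have h1 : ‖Complex.exp a * p‖ ≤ Real.exp (-(c * r)) * Real.exp (-(v / 2) * t ^ 2) := by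
      rw [norm_mul, he, ← Real.exp_add]
      exact (mul_le_of_le_one_right (Real.exp_pos _).le hp).trans (Real.exp_le_exp.2 hre)
    have h3 := norm_sub_le (Complex.exp a * p)
      ((Real.exp (-((v + r * (h ^ 2 + d ^ 2)) / 2) * t ^ 2) : ℝ) : ℂ)
    -- For `|t| ≥ 1` nothing is compared: the Gaussian is itself an error term, absorbed into the
    -- first-moment term.
    have h4 : Real.exp (-(c * r) * t ^ 2) ≤ |t| * Real.exp (-(c * r) * t ^ 2) :=
      le_mul_of_one_le_left (Real.exp_pos _).le ht
    have h5 : 0 ≤ K * (r * h ^ 3) * (|t| ^ 3 * Real.exp (-(c * r) * t ^ 2)) := by positivity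
    have h6 : 0 ≤ |t| * Real.exp (-(c * r) * t ^ 2) := by positivity
    rw [pow_one]
    linarith

/-- The saddle-point approximation, with an explicit error. -/
theorem norm_integral_tilted_sub_le (hd : 0 < d) (hv : 0 < v) (hr : 0 < r) (hh : 1 ≤ h)
    {p : ℝ → ℂ} (hpc : Continuous p) (hp : ∀ t, ‖p t‖ ≤ 1) (hp1 : ∀ t, ‖p t - 1‖ ≤ 2 * |t|) :
    ‖(∫ t, Complex.exp (tiltedExponent d v r h t) * p t)
        - ((√(2 * Real.pi / (v + r * (h ^ 2 + d ^ 2))) : ℝ) : ℂ)‖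
      ≤ ((4 * (1 + d ^ 2) ^ 3 + d ^ 2 + d ^ 4) / (d ^ 2 / (2 + d ^ 2)) ^ 2
          + (3 + √(2 * Real.pi / v)) / (d ^ 2 / (2 + d ^ 2))) * (h ^ 3 / r) := by
  set c := d ^ 2 / (2 + d ^ 2) with hc
  set K := 4 * (1 + d ^ 2) ^ 3 + d ^ 2 + d ^ 4 with hK
  set B := v + r * (h ^ 2 + d ^ 2) with hB
  have hc0 : 0 < c := by positivity
  have hcr : 0 < c * r := by positivity
  have hB0 : 0 < B := by positivity
  have hpw := fun t => norm_tilted_sub_gaussian_le (d := d) hv.le hr.le hh (hp t) (hp1 t)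
  simp only [← hc, ← hK, ← hB] at hpw
  have i1 := (integrable_abs_pow_mul_exp_neg_mul_sq hcr 3).const_mul (K * (r * h ^ 3))
  have i2 := (integrable_abs_pow_mul_exp_neg_mul_sq hcr 1).const_mul 3
  have i3 := (integrable_exp_neg_mul_sq (b := v / 2) (by positivity)).const_mul (Real.exp (-(c * r)))
  have hgi : Integrable (fun t : ℝ => ((Real.exp (-(B / 2) * t ^ 2) : ℝ) : ℂ)) :=
    (integrable_exp_neg_mul_sq (b := B / 2) (by positivity)).ofReal
  have hcont : Continuous fun t => Complex.exp (tiltedExponent d v r h t) * p t := by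
    unfold tiltedExponent
    fun_prop
  have hDi : Integrable (fun t => Complex.exp (tiltedExponent d v r h t) * p t
      - ((Real.exp (-(B / 2) * t ^ 2) : ℝ) : ℂ)) :=
    ((i1.add i2).add i3).mono' (hcont.aestronglyMeasurable.sub hgi.aestronglyMeasurable)
      (.of_forall hpw)
  have hfi : Integrable (fun t => Complex.exp (tiltedExponent d v r h t) * p t) := by
    exact (hDi.add hgi).congr (.of_forall fun t => by simp)
  have hgauss : ∫ t : ℝ, ((Real.exp (-(B / 2) * t ^ 2) : ℝ) : ℂ)
      = ((√(2 * Real.pi / B) : ℝ) : ℂ) := by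
    rw [integral_complex_ofReal, integral_gaussian, div_div_eq_mul_div, mul_comm Real.pi]
  rw [← hgauss, ← integral_sub hfi hgi]
  refine (norm_integral_le_of_norm_le ((i1.add i2).add i3) (.of_forall hpw)).trans ?_
  rw [integral_add' (i1.add i2) i3, integral_add' i1 i2]
  rw [integral_const_mul, integral_const_mul, integral_const_mul, integral_gaussian]
  have e3 := integral_abs_pow_mul_exp_neg_mul_sq hcr 1
  have e1 := integral_abs_pow_mul_exp_neg_mul_sq hcr 0
  norm_num at e3 e1
  simp only [neg_mul, pow_one] at e3 e1 ⊢
  rw [e3, e1]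
  have ee : Real.pi / (v / 2) = 2 * Real.pi / v := by field_simp
  rw [ee]
  -- A crude bound suffices: the cubic term already contributes `h³/r`, and `h ≥ 1`.
  have h1 : Real.exp (-(c * r)) ≤ 1 / (c * r) := by
    rw [Real.exp_neg, one_div]
    exact inv_anti₀ hcr (by linarith [Real.add_one_le_exp (c * r)])
  have h2 : 1 / (c * r) ≤ 1 / c * (h ^ 3 / r) := by
    have : 1 / (c * r) = 1 / c * (1 / r) := by field_simp
    rw [this]
    gcongr
    exact one_le_pow₀ hh
  have h3 : K * (r * h ^ 3) * ((c * r) ^ 2)⁻¹ = K / c ^ 2 * (h ^ 3 / r) := by field_simp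
  have h4 : 3 * (c * r)⁻¹ ≤ 3 * (1 / c * (h ^ 3 / r)) := by
    rw [← one_div]; gcongr
  rw [mul_inv_rev] at h4
  have h5 : Real.exp (-(c * r)) * √(2 * Real.pi / v)
      ≤ 1 / c * (h ^ 3 / r) * √(2 * Real.pi / v) := by
    gcongr; exact h1.trans h2
  have : (K / c ^ 2 + (3 + √(2 * Real.pi / v)) / c) * (h ^ 3 / r) = K / c ^ 2 * (h ^ 3 / r)
     + 3 * (1 / c * (h ^ 3 / r)) + 1 / c * (h ^ 3 / r) * √(2 * Real.pi / v) := by ring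
  rw [this, h3]
  linarith

end Exponent

end MertonModel

namespace MertonModel

open Complex (I)

/-! ### Calculus of relative errors -/

section EqOneAddO

variable {f g g' r r' : ℝ → ℝ}

/-- Boundedness of `r` is what keeps the product of the two errors within `O(r)`. -/
theorem EqOneAddO.trans (h : EqOneAddO f g r) (h' : EqOneAddO g g' r)
    (hr : r =O[atTop] (fun _ => (1 : ℝ))) : EqOneAddO f g' r := by
  obtain ⟨E, hE, hfg⟩ := h
  obtain ⟨E', hE', hgg⟩ := h'
  refine ⟨fun k => E k + E' k + E k * E' k, (hE.add hE').add ?_, ?_⟩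
  · simpa using hE.mul (hE'.trans hr)
  · filter_upwards [hfg, hgg] with k h1 h2
    rw [h1, h2]; ring

theorem eqOneAddO_of_isBigO_div_sub_one (hg : ∀ᶠ k in atTop, g k ≠ 0)
    (h : (fun k => f k / g k - 1) =O[atTop] r) : EqOneAddO f g r := by
  refine ⟨_, h, ?_⟩
  filter_upwards [hg] with k hk
  field_simp
  ring

theorem EqOneAddO.congr_right (h : EqOneAddO f g r) (hg : g =ᶠ[atTop] g') :
    EqOneAddO f g' r := by
  obtain ⟨E, hE, hfg⟩ := h
  refine ⟨E, hE, ?_⟩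
  filter_upwards [hfg, hg] with k h1 h2
  rw [h1, h2]

/-- Change of variables `k = φ (τ k)` in an expansion. -/
theorem EqOneAddO.of_comp {φ τ : ℝ → ℝ} (h : EqOneAddO (fun s => f (φ s)) g r)
    (hτ : Tendsto τ atTop atTop) (hφ : ∀ᶠ k in atTop, φ (τ k) = k)
    (hr : (fun k => r (τ k)) =O[atTop] r') : EqOneAddO f (fun k => g (τ k)) r' := by
  obtain ⟨E, hE, hfg⟩ := h
  refine ⟨fun k => E (τ k), (hE.comp_tendsto hτ).trans hr, ?_⟩
  filter_upwards [hτ.eventually hfg, hφ] with k h1 h2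
  rwa [h2] at h1

end EqOneAddO

/-! ### Saddle-point formula for the call price -/

section Saddle

/-- Completing the square shows that exponential tilting multiplies the jump intensity by
`e^{δ²s²/2+μs}` and shifts the jump mean to `δ²s+μ`. Subtracting `i t m'(s)` centres the tilted law.
-/
theorem cumulantC_add_mul_I (b σ μ lam δ T s t : ℝ) :
    cumulantC b σ μ lam δ T (s + t * I) - t * cumulantDeriv b σ μ lam δ T s * I
      = cumulant b σ μ lam δ T s + tiltedExponent δ (T * σ ^ 2)
          (T * lam * Real.exp (δ ^ 2 * s ^ 2 / 2 + μ * s)) (δ ^ 2 * s + μ) t := by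
  have hsq : (s + t * I : ℂ) ^ 2 = s ^ 2 - t ^ 2 + 2 * s * t * I := by
    linear_combination (t ^ 2 : ℂ) * Complex.I_sq
  have h : Complex.exp (δ ^ 2 * (s + t * I : ℂ) ^ 2 / 2 + μ * (s + t * I))
      = Complex.exp (δ ^ 2 * s ^ 2 / 2 + μ * s) *
        Complex.exp (((δ ^ 2 * s + μ : ℝ) : ℂ) * t * I - δ ^ 2 * t ^ 2 / 2) := by
    rw [← Complex.exp_add, hsq]
    congr 1
    push_cast
    ring
  rw [cumulantC, h, hsq, cumulant, cumulantDeriv, tiltedExponent]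
  push_cast
  ring

theorem norm_callKernel_mul_le {s : ℝ} (hs : 2 ≤ s) (t : ℝ) :
    ‖(s * (s - 1) : ℂ) * callKernel s t‖ ≤ 1 := by
  have h1 : s - 1 ≤ ‖(s - 1 + t * I : ℂ)‖ := by
    simpa using Complex.re_le_norm (s - 1 + t * I : ℂ)
  have h2 : s ≤ ‖(s + t * I : ℂ)‖ := by simpa using Complex.re_le_norm (s + t * I : ℂ)
  have h3 : ‖(s * (s - 1) : ℂ)‖ = s * (s - 1) := by
    rw [show (s * (s - 1) : ℂ) = ((s * (s - 1) : ℝ) : ℂ) by push_cast; rfl, Complex.norm_real,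
      Real.norm_of_nonneg (by nlinarith)]
  rw [callKernel, norm_mul, h3, norm_inv, norm_mul, ← div_eq_mul_inv]
  refine div_le_one_of_le₀ ?_ (by positivity)
  rw [mul_comm]
  exact mul_le_mul h1 h2 (by linarith) (norm_nonneg _)

theorem norm_callKernel_mul_sub_one_le {s : ℝ} (hs : 2 ≤ s) (t : ℝ) :
    ‖(s * (s - 1) : ℂ) * callKernel s t - 1‖ ≤ 2 * |t| := by
  have h1 : 1 ≤ ‖(s - 1 + t * I : ℂ)‖ := by
    have : s - 1 ≤ ‖(s - 1 + t * I : ℂ)‖ := by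
      simpa using Complex.re_le_norm (s - 1 + t * I : ℂ)
    linarith
  have h2 : s ≤ ‖(s + t * I : ℂ)‖ := by simpa using Complex.re_le_norm (s + t * I : ℂ)
  have n1 := sub_one_add_mul_I_ne_zero hs t
  have n2 := add_mul_I_ne_zero hs t
  -- Each of the two terms is `t * I` times a factor of norm at most `1`, whence the constant `2`.
  have e : (s * (s - 1) : ℂ) * callKernel s t - 1
      = -(t * I) * (s + t * I : ℂ)⁻¹ - t * I * (s * ((s - 1 + t * I) * (s + t * I))⁻¹ : ℂ) := by
    rw [callKernel]
    field_simp
    ring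
  have ht : ‖(t * I : ℂ)‖ = |t| := by simp
  have h4 : ‖(s + t * I : ℂ)⁻¹‖ ≤ 1 := by
    rw [norm_inv]; exact inv_le_one_of_one_le₀ (by linarith)
  have h5 : ‖(s * ((s - 1 + t * I) * (s + t * I))⁻¹ : ℂ)‖ ≤ 1 := by
    rw [norm_mul, norm_inv, norm_mul, Complex.norm_real, Real.norm_of_nonneg (by linarith),
      ← div_eq_mul_inv]
    refine div_le_one_of_le₀ ?_ (by positivity)
    nlinarith
  rw [e]
  refine (norm_sub_le _ _).trans ?_
  rw [norm_mul, norm_mul, norm_neg, ht]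
  nlinarith [abs_nonneg t]

variable {Ω : Type*} [MeasurableSpace Ω] {P : Measure Ω} [IsFiniteMeasure P] {X : Ω → ℝ}
    {b σ μ lam δ T : ℝ}

theorem callPrice_saddle_eq (hi : ∀ s : ℝ, Integrable (fun ω => Real.exp (s * X ω)) P)
    (hm : ∀ s, mgf X P s = Real.exp (cumulant b σ μ lam δ T s)) {s : ℝ} (hs : 2 ≤ s) :
    ((2 * Real.pi * callPrice X P (cumulantDeriv b σ μ lam δ T s) * (s * (s - 1)) : ℝ) : ℂ)
      = ((Real.exp (cumulantDeriv b σ μ lam δ T s * (1 - s)) * mgf X P s : ℝ) : ℂ) *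
        ∫ t : ℝ, Complex.exp (tiltedExponent δ (T * σ ^ 2)
          (T * lam * Real.exp (δ ^ 2 * s ^ 2 / 2 + μ * s)) (δ ^ 2 * s + μ) t) *
            ((s * (s - 1) : ℂ) * callKernel s t) := by
  have h := callPrice_eq_integral hi hs (cumulantDeriv b σ μ lam δ T s)
  have e : ∀ t : ℝ, complexMGF X P (s + t * I) *
      Complex.exp (-(t * cumulantDeriv b σ μ lam δ T s * I)) * callKernel s t
      = (mgf X P s : ℂ) * (Complex.exp (tiltedExponent δ (T * σ ^ 2)
          (T * lam * Real.exp (δ ^ 2 * s ^ 2 / 2 + μ * s)) (δ ^ 2 * s + μ) t) *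
            callKernel s t) := fun t => by
    rw [complexMGF_eq_exp_cumulantC hi hm, ← Complex.exp_add, ← sub_eq_add_neg,
      cumulantC_add_mul_I, Complex.exp_add, hm, Complex.ofReal_exp]
    ring
  simp_rw [e] at h
  rw [integral_const_mul] at h
  have e2 : ∀ t : ℝ, Complex.exp (tiltedExponent δ (T * σ ^ 2)
          (T * lam * Real.exp (δ ^ 2 * s ^ 2 / 2 + μ * s)) (δ ^ 2 * s + μ) t) *
            ((s * (s - 1) : ℂ) * callKernel s t)
      = (s * (s - 1) : ℂ) * (Complex.exp (tiltedExponent δ (T * σ ^ 2)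
          (T * lam * Real.exp (δ ^ 2 * s ^ 2 / 2 + μ * s)) (δ ^ 2 * s + μ) t) *
            callKernel s t) := fun t => by ring
  simp_rw [e2]
  rw [integral_const_mul]
  push_cast at h ⊢
  rw [h]
  ring

/-- The saddle-point approximation of the call price, with an explicit relative error. -/
theorem abs_callPrice_div_sub_one_le (hσ : 0 < σ) (hlam : 0 < lam) (hδ : 0 < δ) (hT : 0 < T)
    (hi : ∀ s : ℝ, Integrable (fun ω => Real.exp (s * X ω)) P)
    (hm : ∀ s, mgf X P s = Real.exp (cumulant b σ μ lam δ T s)) :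
    ∃ K : ℝ, ∀ s : ℝ, 2 ≤ s → 1 ≤ δ ^ 2 * s + μ →
      1 ≤ T * lam * Real.exp (δ ^ 2 * s ^ 2 / 2 + μ * s) →
      |callPrice X P (cumulantDeriv b σ μ lam δ T s) /
        (Real.exp (cumulantDeriv b σ μ lam δ T s * (1 - s)) * mgf X P s /
          (s * (s - 1) * √(2 * Real.pi * cumulantDeriv₂ σ μ lam δ T s))) - 1|
      ≤ K * ((δ ^ 2 * s + μ) ^ 4 / √(T * lam * Real.exp (δ ^ 2 * s ^ 2 / 2 + μ * s))) := by
  have hv : 0 < T * σ ^ 2 := by positivity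
  set v := T * σ ^ 2 with hvdef
  set K₁ := (4 * (1 + δ ^ 2) ^ 3 + δ ^ 2 + δ ^ 4) / (δ ^ 2 / (2 + δ ^ 2)) ^ 2
          + (3 + √(2 * Real.pi / v)) / (δ ^ 2 / (2 + δ ^ 2)) with hK₁
  refine ⟨K₁ * √(v + 1 + δ ^ 2), fun s hs hh hr1 => ?_⟩
  have hK0 : 0 ≤ K₁ := by positivity
  set r := T * lam * Real.exp (δ ^ 2 * s ^ 2 / 2 + μ * s) with hr
  set h := δ ^ 2 * s + μ with hhdef
  have hr0 : 0 < r := by positivity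
  have hB : cumulantDeriv₂ σ μ lam δ T s = v + r * (h ^ 2 + δ ^ 2) := by
    rw [cumulantDeriv₂, hr, hhdef, hvdef]; ring
  set B := cumulantDeriv₂ σ μ lam δ T s with hBdef
  set C := callPrice X P (cumulantDeriv b σ μ lam δ T s) with hC
  set G := Real.exp (cumulantDeriv b σ μ lam δ T s * (1 - s)) * mgf X P s with hG
  have hG0 : 0 < G := by rw [hG, hm]; positivity
  have hB0 : 0 < B := by rw [hB]; positivity
  have hss : 0 < s * (s - 1) := by nlinarith
  have hsad := callPrice_saddle_eq hi hm hs
  simp only [← hC, ← hG, ← hvdef, ← hr, ← hhdef] at hsad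
  have hint := norm_integral_tilted_sub_le (v := v) (r := r) (h := h) hδ hv hr0 hh
    (p := fun t => (s * (s - 1) : ℂ) * callKernel s t)
    (continuous_const.mul (continuous_callKernel hs)) (norm_callKernel_mul_le hs)
    (norm_callKernel_mul_sub_one_le hs)
  rw [← hB, ← hK₁] at hint
  set J := ∫ t : ℝ, Complex.exp (tiltedExponent δ v r h t) *
    ((s * (s - 1) : ℂ) * callKernel s t) with hJ
  have hJr : J = ((2 * Real.pi * C * (s * (s - 1)) / G : ℝ) : ℂ) := by
    rw [Complex.ofReal_div, hsad, mul_div_cancel_left₀ _ (Complex.ofReal_ne_zero.2 hG0.ne')]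
  rw [hJr, ← Complex.ofReal_sub, Complex.norm_real, Real.norm_eq_abs] at hint
  -- This product turns the absolute error of the integral into a relative error of the price, at
  -- the cost of a factor `√B`.
  have hsq : √(2 * Real.pi / B) * √(2 * Real.pi * B) = 2 * Real.pi := by
    rw [← Real.sqrt_mul (by positivity), show 2 * Real.pi / B * (2 * Real.pi * B)
      = (2 * Real.pi) * (2 * Real.pi) by field_simp]
    exact Real.sqrt_mul_self (by positivity)
  have hs2 : 0 < √(2 * Real.pi * B) := by positivity
  have e : C / (G / (s * (s - 1) * √(2 * Real.pi * B))) - 1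
      = (2 * Real.pi * C * (s * (s - 1)) / G - √(2 * Real.pi / B)) * √(2 * Real.pi * B)
        / (2 * Real.pi) := by
    rw [sub_mul, hsq]
    field_simp
  have hsB : √(2 * Real.pi * B) / (2 * Real.pi) ≤ √B := by
    rw [Real.sqrt_mul (by positivity), mul_div_right_comm]
    refine mul_le_of_le_one_left (Real.sqrt_nonneg _) ?_
    refine div_le_one_of_le₀ ?_ (by positivity)
    rw [Real.sqrt_le_left (by positivity)]
    nlinarith [Real.pi_gt_three]
  -- As `r, h ≥ 1`, every summand of `B` is at most a constant times `r h²`; multiplied by `h³/r`,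
  -- this leaves `h⁴/√r`.
  have hBle : √B ≤ √(v + 1 + δ ^ 2) * (√r * h) := by
    rw [← Real.sqrt_sq (by linarith : 0 ≤ h), ← Real.sqrt_mul hr0.le, ← Real.sqrt_mul (by positivity)]
    refine Real.sqrt_le_sqrt ?_
    rw [hB]
    have h1 : 1 ≤ h ^ 2 := one_le_pow₀ hh
    have h2 : v * 1 ≤ v * (r * h ^ 2) := by
      gcongr
      nlinarith
    have h3 : r * δ ^ 2 * 1 ≤ r * δ ^ 2 * h ^ 2 := by gcongr
    nlinarith
  rw [e, abs_div, abs_mul, abs_of_pos hs2, abs_of_pos (by positivity : 0 < 2 * Real.pi), mul_div_assoc]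
  calc _ ≤ K₁ * (h ^ 3 / r) * (√(v + 1 + δ ^ 2) * (√r * h)) := by
        gcongr
        exact hsB.trans hBle
    _ = _ := by
        have : r = √r * √r := (Real.mul_self_sqrt hr0.le).symm
        have h0 : 0 < √r := by positivity
        have : h ^ 3 / r * (√r * h) = h ^ 4 / √r := by
          nth_rewrite 1 [this]
          field_simp
        calc _ = K₁ * √(v + 1 + δ ^ 2) * (h ^ 3 / r * (√r * h)) := by ring
          _ = _ := by rw [this]

end Saddle

end MertonModel

namespace MertonModel

/-! ### Growth of the saddle-point quantities -/

section Growth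

variable {b σ μ lam δ T : ℝ}

theorem eventually_jumpExponent_ge (hδ : 0 < δ) (μ A : ℝ) :
    ∀ᶠ s : ℝ in atTop, A * s ≤ δ ^ 2 * s ^ 2 / 2 + μ * s := by
  filter_upwards [eventually_ge_atTop 0, eventually_ge_atTop ((A - μ) / (δ ^ 2 / 2))] with s h0 hs
  rw [div_le_iff₀ (by positivity)] at hs
  nlinarith

theorem eventually_jumpMean_ge (hδ : 0 < δ) (μ : ℝ) :
    ∀ᶠ s : ℝ in atTop, δ ^ 2 / 2 * s ≤ δ ^ 2 * s + μ := by
  filter_upwards [eventually_ge_atTop (-μ / (δ ^ 2 / 2))] with s hs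
  rw [div_le_iff₀ (by positivity)] at hs
  linarith

theorem eventually_one_le_jumpMean (hδ : 0 < δ) (μ : ℝ) :
    ∀ᶠ s : ℝ in atTop, 1 ≤ δ ^ 2 * s + μ := by
  filter_upwards [eventually_ge_atTop ((1 - μ) / δ ^ 2)] with s hs
  rw [div_le_iff₀ (by positivity)] at hs
  linarith

theorem jumpMean_le (δ μ : ℝ) {s : ℝ} (hs : 1 ≤ s) : δ ^ 2 * s + μ ≤ (δ ^ 2 + |μ|) * s := by
  nlinarith [le_abs_self μ, abs_nonneg μ]

theorem eventually_one_le_intensity (hlam : 0 < lam) (hδ : 0 < δ) (hT : 0 < T) (μ : ℝ) :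
    ∀ᶠ s : ℝ in atTop, 1 ≤ T * lam * Real.exp (δ ^ 2 * s ^ 2 / 2 + μ * s) := by
  have h1 : Tendsto (fun s => T * lam * Real.exp s) atTop atTop :=
    Real.tendsto_exp_atTop.const_mul_atTop (by positivity)
  filter_upwards [eventually_jumpExponent_ge hδ μ 1, h1.eventually_ge_atTop 1] with s h2 h3
  refine h3.trans ?_
  gcongr
  linarith

/-- The exponent eventually exceeds `2s`, so the square root exceeds a multiple of `e^s`, which
beats `s⁵`. -/
theorem isBigO_jumpMean_pow_div_sqrt_intensity (hlam : 0 < lam) (hδ : 0 < δ) (hT : 0 < T)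
    (μ : ℝ) :
    (fun s : ℝ => (δ ^ 2 * s + μ) ^ 4 / √(T * lam * Real.exp (δ ^ 2 * s ^ 2 / 2 + μ * s)))
      =O[atTop] (fun s => 1 / s) := by
  have hlim := (Real.tendsto_pow_mul_exp_neg_atTop_nhds_zero 5).eventually_le_const one_pos
  refine IsBigO.of_bound ((δ ^ 2 + |μ|) ^ 4 / √(T * lam)) ?_
  filter_upwards [hlim, eventually_jumpExponent_ge hδ μ 2, eventually_one_le_jumpMean hδ μ,
    eventually_ge_atTop 1] with s h5 hq hh hs
  have hs0 : 0 < s := by linarith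
  rw [Real.norm_of_nonneg (by positivity), Real.norm_of_nonneg (by positivity)]
  have h1 : √(T * lam) * Real.exp s ≤ √(T * lam * Real.exp (δ ^ 2 * s ^ 2 / 2 + μ * s)) := by
    rw [Real.sqrt_mul (mul_pos hT hlam).le (Real.exp _)]
    refine mul_le_mul_of_nonneg_left (Real.le_sqrt_of_sq_le ?_) (Real.sqrt_nonneg _)
    rw [← Real.exp_nat_mul]
    exact Real.exp_le_exp.2 (by push_cast; linarith)
  have h2 : s ^ 4 / Real.exp s ≤ 1 / s := by
    rw [Real.exp_neg] at h5
    rw [div_le_div_iff₀ (Real.exp_pos _) hs0]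
    rw [← div_eq_mul_inv, div_le_one (Real.exp_pos _)] at h5
    linarith
  calc _ ≤ ((δ ^ 2 + |μ|) * s) ^ 4 / (√(T * lam) * Real.exp s) := by
        gcongr
        exact jumpMean_le δ μ hs
    _ = (δ ^ 2 + |μ|) ^ 4 / √(T * lam) * (s ^ 4 / Real.exp s) := by
        field_simp
    _ ≤ _ := by gcongr

/-- The term `e^q` with `q = δ²s²/2 + μs` dominates `m'`: its prefactor lies between `Tλ` and a
multiple of `e^s`, so logarithms differ from `q` by `O(s)`, and `μs` is of that order too. -/
theorem exists_abs_log_cumulantDeriv_sub_le (hσ : 0 < σ) (hlam : 0 < lam) (hδ : 0 < δ)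
    (hT : 0 < T) (b μ : ℝ) : ∃ A : ℝ, 0 ≤ A ∧ ∀ᶠ s : ℝ in atTop,
      |Real.log (cumulantDeriv b σ μ lam δ T s) - δ ^ 2 * s ^ 2 / 2| ≤ A * s := by
  set K := T * (σ ^ 2 + |b|) + T * lam * (δ ^ 2 + |μ|) with hK
  have hK0 : 0 < K := by positivity
  refine ⟨|μ| + 1 + |Real.log K| + |Real.log (T * lam)|, by positivity, ?_⟩
  filter_upwards [eventually_jumpExponent_ge hδ μ 0, eventually_one_le_jumpMean hδ μ,
    eventually_ge_atTop 1, eventually_ge_atTop (-b / σ ^ 2)] with s hq hh hs hb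
  rw [zero_mul] at hq
  rw [div_le_iff₀ (by positivity)] at hb
  have hs0 : 0 < s := by linarith
  set q := δ ^ 2 * s ^ 2 / 2 + μ * s with hqdef
  have hm : cumulantDeriv b σ μ lam δ T s
      = T * (σ ^ 2 * s + b) + T * lam * (δ ^ 2 * s + μ) * Real.exp q := by
    rw [cumulantDeriv]; ring
  have hlow : T * lam * Real.exp q ≤ cumulantDeriv b σ μ lam δ T s := by
    rw [hm]
    have h1 : T * lam * 1 * Real.exp q ≤ T * lam * (δ ^ 2 * s + μ) * Real.exp q := by gcongr
    have h2 : 0 ≤ T * (σ ^ 2 * s + b) := mul_nonneg hT.le (by linarith)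
    linarith
  have hup : cumulantDeriv b σ μ lam δ T s ≤ K * (Real.exp s * Real.exp q) := by
    have h1 : T * lam * (δ ^ 2 * s + μ) * Real.exp q
        ≤ T * lam * ((δ ^ 2 + |μ|) * s) * Real.exp q := by
      gcongr
      exact jumpMean_le δ μ hs
    have h2 : T * (σ ^ 2 * s + b) ≤ T * ((σ ^ 2 + |b|) * s) := by
      gcongr
      nlinarith [le_abs_self b, abs_nonneg b]
    have h3 : T * ((σ ^ 2 + |b|) * s) ≤ T * ((σ ^ 2 + |b|) * s) * Real.exp q :=
      le_mul_of_one_le_right (by positivity) (Real.one_le_exp hq)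
    have h4 : K * (s * Real.exp q) ≤ K * (Real.exp s * Real.exp q) := by
      gcongr
      linarith [Real.add_one_le_exp s]
    rw [hm]
    refine le_trans ?_ h4
    rw [hK]
    linarith
  have hTl : 0 < T * lam := by positivity
  have hpos : 0 < T * lam * Real.exp q := by positivity
  have l1 := Real.log_le_log hpos hlow
  have l2 := Real.log_le_log (hpos.trans_le hlow) hup
  rw [Real.log_mul hTl.ne' (Real.exp_pos _).ne', Real.log_exp] at l1
  rw [← Real.exp_add, Real.log_mul hK0.ne' (Real.exp_pos _).ne', Real.log_exp] at l2
  have a1 : |μ * s| ≤ |μ| * s := by rw [abs_mul, abs_of_pos hs0]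
  have a2 : |Real.log K| ≤ |Real.log K| * s := le_mul_of_one_le_right (abs_nonneg _) hs
  have a3 : |Real.log (T * lam)| ≤ |Real.log (T * lam)| * s :=
    le_mul_of_one_le_right (abs_nonneg _) hs
  have a4 := le_abs_self (Real.log K)
  have a5 := neg_abs_le (Real.log (T * lam))
  have a6 := le_abs_self (μ * s)
  have a7 := neg_abs_le (μ * s)
  have a8 : 0 ≤ |Real.log K| * s := by positivity
  have a9 : 0 ≤ |Real.log (T * lam)| * s := by positivity
  rw [abs_le]
  constructor <;> linarith

theorem eventually_log_cumulantDeriv_pos (hσ : 0 < σ) (hlam : 0 < lam) (hδ : 0 < δ)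
    (hT : 0 < T) (b μ : ℝ) :
    ∀ᶠ s : ℝ in atTop, 0 < Real.log (cumulantDeriv b σ μ lam δ T s) := by
  obtain ⟨A, hA, h⟩ := exists_abs_log_cumulantDeriv_sub_le hσ hlam hδ hT b μ
  -- The drift is set to `0` because only `δ²s²/2` has to beat `(A + 1) * s`.
  filter_upwards [h, eventually_jumpExponent_ge hδ 0 (A + 1), eventually_gt_atTop 0]
    with s h1 h2 h3
  have := (abs_le.1 h1).1
  linarith

/-- Both `2 log m'(s) / δ²` and `s(s-1)` are `s² + O(s)`. This replacement fixes the order of the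
final error term. -/
theorem isBigO_log_cumulantDeriv_div_sub_one (hσ : 0 < σ) (hlam : 0 < lam) (hδ : 0 < δ)
    (hT : 0 < T) (b μ : ℝ) :
    (fun s => 2 * Real.log (cumulantDeriv b σ μ lam δ T s) / (δ ^ 2 * (s * (s - 1))) - 1)
      =O[atTop] (fun s => 1 / s) := by
  obtain ⟨A, hA, h⟩ := exists_abs_log_cumulantDeriv_sub_le hσ hlam hδ hT b μ
  refine IsBigO.of_bound (2 * (2 * A + δ ^ 2) / δ ^ 2) ?_
  filter_upwards [h, eventually_ge_atTop 2] with s h1 hs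
  have hs0 : 0 < s := by linarith
  have hs1 : 0 < s - 1 := by linarith
  set L := Real.log (cumulantDeriv b σ μ lam δ T s)
  have e : 2 * L / (δ ^ 2 * (s * (s - 1))) - 1
      = (2 * (L - δ ^ 2 * s ^ 2 / 2) + δ ^ 2 * s) / (δ ^ 2 * (s * (s - 1))) := by
    field_simp
    ring
  have hn : |2 * (L - δ ^ 2 * s ^ 2 / 2) + δ ^ 2 * s| ≤ (2 * A + δ ^ 2) * s := by
    refine (abs_add_le _ _).trans ?_
    rw [abs_mul, abs_two, abs_of_pos (by positivity : 0 < δ ^ 2 * s)]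
    linarith
  rw [e, norm_div, Real.norm_eq_abs, Real.norm_of_nonneg (by positivity : 0 ≤ 1 / s),
    Real.norm_of_nonneg (by positivity)]
  calc _ ≤ (2 * A + δ ^ 2) * s / (δ ^ 2 * (s * (s / 2))) := by
        gcongr
        linarith
    _ = _ := by field_simp

/-- Used at the saddle point to convert `O(1/s)` into `O(1/√log k)`. -/
theorem eventually_sqrt_log_cumulantDeriv_le (hσ : 0 < σ) (hlam : 0 < lam) (hδ : 0 < δ)
    (hT : 0 < T) (b μ : ℝ) : ∃ A : ℝ, 0 < A ∧ ∀ᶠ s : ℝ in atTop,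
      √(Real.log (cumulantDeriv b σ μ lam δ T s)) ≤ A * s := by
  obtain ⟨A, hA, h⟩ := exists_abs_log_cumulantDeriv_sub_le hσ hlam hδ hT b μ
  refine ⟨√(δ ^ 2 / 2 + A), by positivity, ?_⟩
  filter_upwards [h, eventually_ge_atTop 1] with s h1 hs
  refine Real.sqrt_le_iff.2 ⟨by positivity, ?_⟩
  rw [mul_pow, Real.sq_sqrt (by positivity)]
  have h2 := (abs_le.1 h1).2
  have h3 : A * s ≤ A * s ^ 2 := by
    gcongr
    exact le_self_pow₀ hs two_ne_zero
  linarith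

theorem abs_sqrt_sub_one_le {x : ℝ} (hx : 0 ≤ x) : |√x - 1| ≤ |x - 1| := by
  have h : x - 1 = (√x - 1) * (√x + 1) := by
    have := Real.mul_self_sqrt hx
    linarith
  rw [h, abs_mul]
  refine le_mul_of_one_le_right (abs_nonneg _) ?_
  rw [abs_of_nonneg (by positivity)]
  linarith [Real.sqrt_nonneg x]

/-- The second derivative of the cumulant generating function with `δ²` replaced by
`δ² (δ² s + μ)`. -/
noncomputable def cumulantDerivVariant (σ μ lam δ T s : ℝ) : ℝ :=
  T * (σ ^ 2 + lam * (δ ^ 2 * s + μ) * ((δ ^ 2 * s + μ) + δ ^ 2) *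
    Real.exp (δ ^ 2 * s ^ 2 / 2 + μ * s))

/-- The two expressions differ by `Tλ e^q δ²(h-1)`, while `m''` is at least `Tλ e^q h²`; the
relative difference is at most `δ²/h`, and `h ≥ δ²s/2` eventually. -/
theorem isBigO_sqrt_variant_div_sub_one (hσ : 0 < σ) (hlam : 0 < lam) (hδ : 0 < δ)
    (hT : 0 < T) (μ : ℝ) :
    (fun s => √(cumulantDerivVariant σ μ lam δ T s / cumulantDeriv₂ σ μ lam δ T s) - 1)
      =O[atTop] (fun s => 1 / s) := by
  refine IsBigO.of_bound 2 ?_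
  filter_upwards [eventually_one_le_jumpMean hδ μ, eventually_jumpMean_ge hδ μ,
    eventually_gt_atTop 0] with s hh hh2 hs
  rw [cumulantDerivVariant, cumulantDeriv₂]
  set h := δ ^ 2 * s + μ with hdef
  set q := Real.exp (δ ^ 2 * s ^ 2 / 2 + μ * s) with hq
  have hh0 : 0 < h := by linarith
  have hq0 : 0 < q := Real.exp_pos _
  rw [Real.norm_eq_abs, Real.norm_of_nonneg (by positivity : 0 ≤ 1 / s)]
  refine (abs_sqrt_sub_one_le (by positivity)).trans ?_
  have hB : 0 < T * (σ ^ 2 + lam * (h ^ 2 + δ ^ 2) * q) := by positivity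
  rw [div_sub_one hB.ne', abs_div, abs_of_pos hB]
  have e : T * (σ ^ 2 + lam * h * (h + δ ^ 2) * q) - T * (σ ^ 2 + lam * (h ^ 2 + δ ^ 2) * q)
      = T * lam * q * δ ^ 2 * (h - 1) := by ring
  rw [e, abs_of_nonneg (mul_nonneg (by positivity) (by linarith))]
  have hle : T * lam * q * h ^ 2 ≤ T * (σ ^ 2 + lam * (h ^ 2 + δ ^ 2) * q) := by
    have : 0 ≤ T * σ ^ 2 + T * lam * q * δ ^ 2 := by positivity
    linarith
  calc _ ≤ T * lam * q * δ ^ 2 * h / (T * lam * q * h ^ 2) :=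
        div_le_div₀ (by positivity) (mul_le_mul_of_nonneg_left (by linarith) (by positivity))
          (by positivity) hle
    _ = δ ^ 2 / h := by field_simp
    _ ≤ δ ^ 2 / (δ ^ 2 / 2 * s) := by gcongr
    _ = _ := by field_simp

end Growth

/-! ### Expansions in the saddle point and passage to the strike -/

section Expansion

variable {Ω : Type*} [MeasurableSpace Ω] {P : Measure Ω} [IsFiniteMeasure P] {X : Ω → ℝ}
    {b σ μ lam δ T : ℝ}

theorem cumulantDeriv₂_pos (hσ : 0 < σ) (hlam : 0 < lam) (hT : 0 < T) (μ δ s : ℝ) :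
    0 < cumulantDeriv₂ σ μ lam δ T s := by
  unfold cumulantDeriv₂
  positivity

/-- The call price expansion in terms of the saddle point. -/
theorem callPrice_expansion (hσ : 0 < σ) (hlam : 0 < lam) (hδ : 0 < δ) (hT : 0 < T)
    (hi : ∀ s : ℝ, Integrable (fun ω => Real.exp (s * X ω)) P)
    (hm : ∀ s, mgf X P s = Real.exp (cumulant b σ μ lam δ T s)) :
    EqOneAddO (fun s => callPrice X P (cumulantDeriv b σ μ lam δ T s))
      (fun s => δ ^ 2 * (Real.exp (cumulantDeriv b σ μ lam δ T s * (1 - s)) * mgf X P s) /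
        (2 * Real.log (cumulantDeriv b σ μ lam δ T s) *
          √(2 * Real.pi * cumulantDeriv₂ σ μ lam δ T s))) (fun s => 1 / s) := by
  have hbdd : (fun s : ℝ => 1 / s) =O[atTop] (fun _ => (1 : ℝ)) := by
    simpa only [one_div] using tendsto_inv_atTop_zero.isBigO_one ℝ
  have hG : ∀ s, 0 < Real.exp (cumulantDeriv b σ μ lam δ T s * (1 - s)) * mgf X P s := fun s => by
    rw [hm]; positivity
  have hsq : ∀ s, 0 < √(2 * Real.pi * cumulantDeriv₂ σ μ lam δ T s) := fun s => by
    have := cumulantDeriv₂_pos hσ hlam hT μ δ s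
    positivity
  -- The intermediate function is the saddle-point formula with `s(s-1)`; its error is negligible
  -- next to that of introducing the logarithm.
  refine EqOneAddO.trans (g := fun s =>
    Real.exp (cumulantDeriv b σ μ lam δ T s * (1 - s)) * mgf X P s /
      (s * (s - 1) * √(2 * Real.pi * cumulantDeriv₂ σ μ lam δ T s))) ?_ ?_ hbdd
  · refine eqOneAddO_of_isBigO_div_sub_one ?_ ?_
    · filter_upwards [eventually_ge_atTop 2] with s hs
      have : 0 < s * (s - 1) := by nlinarith
      exact (div_pos (hG s) (mul_pos this (hsq s))).ne'
    · obtain ⟨K, hK⟩ := abs_callPrice_div_sub_one_le hσ hlam hδ hT hi hm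
      refine IsBigO.trans (IsBigO.of_bound |K| ?_)
        (isBigO_jumpMean_pow_div_sqrt_intensity hlam hδ hT μ)
      filter_upwards [eventually_ge_atTop 2, eventually_one_le_jumpMean hδ μ,
        eventually_one_le_intensity hlam hδ hT μ] with s h1 h2 h3
      rw [Real.norm_eq_abs]
      refine (hK s h1 h2 h3).trans ((le_abs_self _).trans ?_)
      rw [abs_mul, Real.norm_eq_abs]
  · have hpos := eventually_log_cumulantDeriv_pos hσ hlam hδ hT b μ
    refine eqOneAddO_of_isBigO_div_sub_one ?_ ?_
    · filter_upwards [hpos] with s hs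
      exact (div_pos (mul_pos (by positivity) (hG s)) (mul_pos (by positivity) (hsq s))).ne'
    · refine (isBigO_log_cumulantDeriv_div_sub_one hσ hlam hδ hT b μ).congr' ?_ .rfl
      filter_upwards [hpos, eventually_ge_atTop 2] with s hs h2
      have h3 : s - 1 ≠ 0 := by linarith
      have h4 : s ≠ 0 := by linarith
      have := (hG s).ne'
      have := (hsq s).ne'
      congr 1
      generalize Real.exp (cumulantDeriv b σ μ lam δ T s * (1 - s)) * mgf X P s = G at *
      field_simp

theorem callPrice_expansion_variant (hσ : 0 < σ) (hlam : 0 < lam) (hδ : 0 < δ) (hT : 0 < T)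
    (hi : ∀ s : ℝ, Integrable (fun ω => Real.exp (s * X ω)) P)
    (hm : ∀ s, mgf X P s = Real.exp (cumulant b σ μ lam δ T s)) :
    EqOneAddO (fun s => callPrice X P (cumulantDeriv b σ μ lam δ T s))
      (fun s => δ ^ 2 * (Real.exp (cumulantDeriv b σ μ lam δ T s * (1 - s)) * mgf X P s) /
        (2 * Real.log (cumulantDeriv b σ μ lam δ T s) *
          √(2 * Real.pi * cumulantDerivVariant σ μ lam δ T s))) (fun s => 1 / s) := by
  have hbdd : (fun s : ℝ => 1 / s) =O[atTop] (fun _ => (1 : ℝ)) := by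
    simpa only [one_div] using tendsto_inv_atTop_zero.isBigO_one ℝ
  refine (callPrice_expansion hσ hlam hδ hT hi hm).trans ?_ hbdd
  have hpos := eventually_log_cumulantDeriv_pos hσ hlam hδ hT b μ
  have hG : ∀ s, 0 < Real.exp (cumulantDeriv b σ μ lam δ T s * (1 - s)) * mgf X P s := fun s => by
    rw [hm]; positivity
  have hV : ∀ᶠ s in atTop, 0 < cumulantDerivVariant σ μ lam δ T s := by
    filter_upwards [eventually_one_le_jumpMean hδ μ] with s hs
    have : 0 < δ ^ 2 * s + μ := by linarith
    unfold cumulantDerivVariant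
    positivity
  refine eqOneAddO_of_isBigO_div_sub_one ?_ ?_
  · filter_upwards [hpos, hV] with s hs hv
    have := hG s
    positivity
  · refine (isBigO_sqrt_variant_div_sub_one hσ hlam hδ hT μ).congr' ?_ .rfl
    filter_upwards [hpos, hV] with s hs hv
    have hB := cumulantDeriv₂_pos hσ hlam hT μ δ s
    have hGs := hG s
    congr 1
    generalize Real.exp (cumulantDeriv b σ μ lam δ T s * (1 - s)) * mgf X P s = G at *
    rw [← mul_div_mul_left (cumulantDerivVariant σ μ lam δ T s) _
      (by positivity : 2 * Real.pi ≠ 0), Real.sqrt_div (by positivity)]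
    have h1 : 0 < √(2 * Real.pi * cumulantDerivVariant σ μ lam δ T s) := by positivity
    have h2 : 0 < √(2 * Real.pi * cumulantDeriv₂ σ μ lam δ T s) := by positivity
    generalize √(2 * Real.pi * cumulantDerivVariant σ μ lam δ T s) = x at *
    generalize √(2 * Real.pi * cumulantDeriv₂ σ μ lam δ T s) = y at *
    field_simp

theorem tendsto_saddlePoint (hσ : 0 < σ) (hlam : 0 < lam) (hT : 0 < T) {τ : ℝ → ℝ}
    (hτ : ∀ᶠ k in atTop, cumulantDeriv b σ μ lam δ T (τ k) = k) : Tendsto τ atTop atTop := by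
  refine tendsto_atTop.2 fun A => ?_
  filter_upwards [hτ, eventually_ge_atTop (cumulantDeriv b σ μ lam δ T A)] with k h1 h2
  rw [← h1] at h2
  exact (strictMono_cumulantDeriv hσ hlam.le hT).le_iff_le.1 h2

theorem isBigO_one_div_saddlePoint (hσ : 0 < σ) (hlam : 0 < lam) (hδ : 0 < δ) (hT : 0 < T)
    {τ : ℝ → ℝ} (hτ : ∀ᶠ k in atTop, cumulantDeriv b σ μ lam δ T (τ k) = k) :
    (fun k => 1 / τ k) =O[atTop] (fun k => 1 / √(Real.log k)) := by
  have ht := tendsto_saddlePoint hσ hlam hT hτ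
  obtain ⟨A, hA, h⟩ := eventually_sqrt_log_cumulantDeriv_le hσ hlam hδ hT b μ
  refine IsBigO.of_bound A ?_
  filter_upwards [ht.eventually h, hτ, ht.eventually_gt_atTop 0, eventually_gt_atTop 1]
    with k h1 h2 h3 h4
  rw [h2] at h1
  have hl : 0 < √(Real.log k) := Real.sqrt_pos.2 (Real.log_pos h4)
  rw [Real.norm_of_nonneg (by positivity), Real.norm_of_nonneg (by positivity), mul_one_div,
    div_le_div_iff₀ h3 hl]
  linarith

end Expansion

end MertonModel

theorem mainTheorem3 {Ω : Type*} [MeasurableSpace Ω] (P : Measure Ω) [IsProbabilityMeasure P]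
    (b σ μ : ℝ) (lam δ T : ℝ≥0) (hσ : 0 < σ) (hlam : 0 < lam) (hδ : 0 < δ) (hT : 0 < T)
    (W : ℝ≥0 → Ω → ℝ) (N : ℝ≥0 → Ω → ℕ) (Y : ℕ → Ω → ℝ)
    (hnoise : MertonModel.IsMertonNoise W N Y lam μ δ P)
    (X : Ω → ℝ) (hX : X = MertonModel.logReturn b σ W N Y T) :
    -- the moment generating function, the call price and the saddle point are well defined
    (∀ s : ℝ, Integrable (fun ω => Real.exp (s * X ω)) P) ∧
    (∀ k : ℝ, Integrable (fun ω => MertonModel.callPayoff k (X ω)) P) ∧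
    (∀ k : ℝ, ∃! s : ℝ, deriv (cgf X P) s = k) ∧
    -- the expansions at the saddle point
    ∀ shat : ℝ → ℝ, (∀ᶠ k in atTop, deriv (cgf X P) (shat k) = k) →
      MertonModel.EqOneAddO (MertonModel.callPrice X P)
        (fun k => (δ : ℝ) ^ 2 * Real.exp (k * (1 - shat k)) * mgf X P (shat k) /
          (2 * Real.log k * √(2 * Real.pi * iteratedDeriv 2 (cgf X P) (shat k))))
        (fun k => 1 / √(Real.log k)) ∧
      MertonModel.EqOneAddO (MertonModel.callPrice X P)
        (fun k => (δ : ℝ) ^ 2 *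
          Real.exp (k * (1 - shat k) + T * (σ ^ 2 * shat k ^ 2 / 2 + b * shat k +
            lam * (Real.exp ((δ : ℝ) ^ 2 * shat k ^ 2 / 2 + μ * shat k) - 1))) /
          (2 * Real.log k * √(2 * Real.pi * T * (σ ^ 2 +
            lam * (((δ : ℝ) ^ 2 * shat k + μ) ^ 2 + (δ : ℝ) ^ 2) *
              Real.exp ((δ : ℝ) ^ 2 * shat k ^ 2 / 2 + μ * shat k)))))
        (fun k => 1 / √(Real.log k)) ∧
      MertonModel.EqOneAddO (MertonModel.callPrice X P)
        (fun k => (δ : ℝ) ^ 2 *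
          Real.exp (k * (1 - shat k) + T * (σ ^ 2 * shat k ^ 2 / 2 + b * shat k +
            lam * (Real.exp ((δ : ℝ) ^ 2 * shat k ^ 2 / 2 + μ * shat k) - 1))) /
          (2 * Real.log k * √(2 * Real.pi * T * (σ ^ 2 +
            lam * ((δ : ℝ) ^ 2 * shat k + μ) * (((δ : ℝ) ^ 2 * shat k + μ) + (δ : ℝ) ^ 2) *
              Real.exp ((δ : ℝ) ^ 2 * shat k ^ 2 / 2 + μ * shat k)))))
        (fun k => 1 / √(Real.log k)) := by
  subst hX
  have hlam' : (0 : ℝ) < lam := NNReal.coe_pos.2 hlam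
  have hδ' : (0 : ℝ) < δ := NNReal.coe_pos.2 hδ
  have hT' : (0 : ℝ) < T := NNReal.coe_pos.2 hT
  have hi := fun s => (hnoise.mgf_logReturn b σ T s).1
  have hm := fun s => (hnoise.mgf_logReturn b σ T s).2
  have hcgf := MertonModel.cgf_eq_cumulant hm
  rw [hcgf, MertonModel.deriv_cumulant, MertonModel.iteratedDeriv_two_cumulant]
  refine ⟨hi, MertonModel.integrable_callPayoff hi,
    MertonModel.existsUnique_cumulantDeriv_eq hσ hlam'.le hT', fun τ hτ => ?_⟩
  have ht := MertonModel.tendsto_saddlePoint hσ hlam' hT' hτ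
  have hr := MertonModel.isBigO_one_div_saddlePoint hσ hlam' hδ' hT' hτ
  -- Expansions in `s` with strike `m'(s)` become expansions in `k` by substituting `s = τ k`, for
  -- which `m'(τ k) = k` eventually.
  have h1 := (MertonModel.callPrice_expansion hσ hlam' hδ' hT' hi hm).of_comp ht hτ hr
  have h3 := (MertonModel.callPrice_expansion_variant hσ hlam' hδ' hT' hi hm).of_comp ht hτ hr
  refine ⟨h1.congr_right ?_, h1.congr_right ?_, h3.congr_right ?_⟩
  · filter_upwards [hτ] with k hk
    rw [hk, ← mul_assoc ((δ : ℝ) ^ 2)]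
  · filter_upwards [hτ] with k hk
    rw [hk, hm, ← Real.exp_add, MertonModel.cumulantDeriv₂, ← mul_assoc (2 * Real.pi)]
    rfl
  · filter_upwards [hτ] with k hk
    rw [hk, hm, ← Real.exp_add, MertonModel.cumulantDerivVariant, ← mul_assoc (2 * Real.pi)]
    rfl
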